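/- **Theorem 3.5.** *Conventions.* For words $x,y$ over finite alphabets, $\mathrm{conv}(x,y)$ is the word of length $\max\{|x|,|y|\}$ whose $i$-th letter is the pair of the $i$-th letters of $x$ and $y$, the shorter word being padded with a new symbol $\boxdot$; similarly for more words. A family $\{L_e : e\in I\}$ of languages indexed by words is *automatic* if $I$ and $\{\mathrm{conv}(e,x) : e\in I,\ x\in L_e\}$ are regular. A *text* for a language $S$ is a sequence $w_0,w_1,\dots$ with $\{w_n : n\in\mathbb N\}=S$. A learner starts with a fixed initial memory; in cycle $n$ it maps its memory and the datum $w_n$ to a new memory and a conjecture $e_n$. With hypothesis space $\{H_d : d\in J\}\supseteq\{L_e: e\in I\}$, it *learns* $\{L_e : e\in I\}$ if, for every $e\in I$ and every text for $L_e$, the conjectures are eventually constant with a value $d\in J$ such that $H_d=L_e$. An *automatic learner* is a learner whose memories are words over a finite alphabet and for which the set of all $\mathrm{conv}(om,dat,nm,nc)$, such that the (old memory, datum) pair $(om,dat)$ is mapped to the (new memory, new conjecture) pair $(nm,nc)$, is regular. A *linear-time learner with $k$ additional work tapes* is a deterministic Turing machine with tapes $0,1,\dots,k$. Each tape is one-sided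 infinite, with an unmodifiable marker $\boxplus$ that occurs exactly in its cell $0$ and with blank symbol $\boxdot$. Each cycle starts in the start state, with $\boxplus\,\mathrm{conv}(dat,om)\,\boxdot^\infty$ on Tape $0$ and the head of Tape $0$ on $\boxplus$, where $dat$ is the current datum and $om$ the old memory. The cycle ends when a final state is reached; the content of Tape $0$ then begins with $\boxplus\,\mathrm{conv}(nm,nc)\,\boxdot$, where $nm$ is the new memory and $nc$ the conjecture. Tapes $1,\dots,k$ are empty, with their heads on $\boxplus$, before the first cycle, and their contents and head positions are unchanged between cycles. There is a constant $c$ such that, on every sequence of data, every cycle takes at most $c\cdot(|\mathrm{conv}(dat,om)|+1)$ steps, $|\mathrm{conv}(nm,nc)|\le\ell+c$, and the head of Tape $0$ stays in the cells $0,\dots,\ell+c$, where $\ell$ is the length of the longest datum seen so far (including the current one). *Statement.* Let $I=\{0,1\}^*$ and, for each $x\in\{0,1\}^*$, let $$L_\varepsilon=\{0,1\}^*,\qquad L_{x0}=(\{0,1\}^*\cup\{x2\})-\{x\},\qquad L_{x1}=\{0,1\}^*\cup\{x2\}.$$ Then $\{L_e : e\in I\}$ is an automatic family over the alphabet $\{0,1,2\}$.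 It has no automatic learner, whichever automatic family is used as the hypothesis space. It is, however, learnt by a linear-time learner with one additional work tape that uses $\{L_e : e\in I\}$ itself as the hypothesis space and that, on every text for a language of the family, conjectures only elements of $I$. -/

import Mathlib

namespace AutomaticLearning

/-! ### Convolutions and automatic families -/

/-- The convolution of two words: the word of length `max |x| |y|` whose `i`-th letter is the pair of
the `i`-th letters of `x` and `y`, where `none` plays the part of the padding symbol `⊡`. -/
def conv {A B : Type} (x : List A) (y : List B) : List (Option A × Option B) :=
  (List.range (max x.length y.length)).map fun i => (x[i]?, y[i]?)

/-- The convolution of four words. -/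
def conv₄ {A B C D : Type} (x : List A) (y : List B) (z : List C) (u : List D) :
    List (Option A × Option B × Option C × Option D) :=
  (List.range (max (max x.length y.length) (max z.length u.length))).map fun i =>
    (x[i]?, y[i]?, z[i]?, u[i]?)

/-- A set of words is regular if it is recognised by a deterministic finite automaton. -/
def IsRegularSet {A : Type} (S : Set (List A)) : Prop :=
  Language.IsRegular (T := A) S

/-- The family `{L e : e ∈ I}` (of languages over `A`, with indices that are words over `D`) is
automatic. The values `L e` with `e ∉ I` do not matter. -/
def IsAutomaticFamily {A D : Type} (I : Set (List D)) (L : List D → Set (List A)) : Prop :=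
  IsRegularSet I ∧ IsRegularSet {u | ∃ e ∈ I, ∃ x ∈ L e, u = conv e x}

/-- `{H d : d ∈ J}` is a hypothesis space for `{L e : e ∈ I}`: it contains every `L e`. -/
def IsHypothesisSpace {A D E : Type} (J : Set (List E)) (H : List E → Set (List A))
    (I : Set (List D)) (L : List D → Set (List A)) : Prop :=
  ∀ e ∈ I, ∃ d ∈ J, H d = L e

/-! ### Learning in the limit -/

/-- A text for `S` lists all elements of `S`, and nothing else, in any order and with repetitions
allowed. -/
def IsText {A : Type} (w : ℕ → List A) (S : Set (List A)) : Prop :=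
  Set.range w = S

/-- The sequence of conjectures `hyp` is eventually constant, its final value being an index of `S`
in the hypothesis space `{H d : d ∈ J}`. -/
def ConvergesTo {A E : Type} (J : Set (List E)) (H : List E → Set (List A))
    (hyp : ℕ → List E) (S : Set (List A)) : Prop :=
  ∃ n, hyp n ∈ J ∧ H (hyp n) = S ∧ ∀ m ≥ n, hyp m = hyp n

/-! ### Automatic learners -/

/-- `M` is a (possibly partial) map from (old memory, datum) to (new memory, new conjecture).
It is automatic if the convolutions `conv(om, dat, nm, nc)` with `M(om, dat) = (nm, nc)` form a
regular set. -/
def IsAutomaticMap {A G E : Type} (M : List G → List A → Option (List G × List E)) : Prop :=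
  IsRegularSet {u | ∃ om dat nm nc, M om dat = some (nm, nc) ∧ u = conv₄ om dat nm nc}

/-- The class `{L e : e ∈ I}` is learnt by some automatic learner that uses the hypothesis space
`{H d : d ∈ J}`. The memory alphabet `G` and the initial memory `m₀` are arbitrary; `mem n` is the
memory before the datum `w n` is processed, and `hyp n` the conjecture issued after it. Nothing is
asked of `M` off the texts of the class, and conjectures that are abandoned later may be arbitrary
words. -/
def HasAutomaticLearner {A D E : Type} (J : Set (List E)) (H : List E → Set (List A))
    (I : Set (List D)) (L : List D → Set (List A)) : Prop :=
  ∃ (G : Type) (_ : Finite G) (M : List G → List A → Option (List G × List E)) (m₀ : List G),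
    IsAutomaticMap M ∧
    ∀ e ∈ I, ∀ w : ℕ → List A, IsText w (L e) →
      ∃ (mem : ℕ → List G) (hyp : ℕ → List E),
        mem 0 = m₀ ∧
        (∀ n, M (mem n) (w n) = some (mem (n + 1), hyp n)) ∧
        ConvergesTo J H hyp (L e)

/-! ### Turing machines with one-sided infinite tapes -/

/-- What a head can see: the left end marker `⊞`, an empty cell `⊡`, or a letter. -/
inductive Cell (B : Type) where
  | leftEnd : Cell B
  | blank : Cell B
  | letter (b : B) : Cell B

/-- A head moves by one cell to the left or to the right, or stays. -/
inductive Move where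
  | left
  | stay
  | right

/-- A one-sided infinite tape with its head. Cell number `0` holds `⊞`; the content of cell number
`i ≥ 1` is `cell i`, where `none` is the blank symbol `⊡` (the value `cell 0` is never used). -/
structure Tape (B : Type) where
  head : ℕ
  cell : ℕ → Option B

/-- The tape `⊞ u ⊡ ⊡ ⊡ …` with its head on `⊞`. -/
def Tape.ofWord {B : Type} (u : List B) : Tape B where
  head := 0
  cell := fun i => if i = 0 then none else u[i - 1]?

/-- The content of the tape starts with `⊞ u ⊡`. -/
def Tape.Holds {B : Type} (t : Tape B) (u : List B) : Prop :=
  ∀ i ≤ u.length, t.cell (i + 1) = u[i]?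

/-- The symbol under the head. -/
def Tape.read {B : Type} (t : Tape B) : Cell B :=
  if t.head = 0 then Cell.leftEnd
  else match t.cell t.head with
    | none => Cell.blank
    | some b => Cell.letter b

/-- Write `s` under the head, and then move the head. The marker `⊞` cannot be overwritten (nor
written elsewhere), and a head on `⊞` that is sent to the left stays where it is. -/
def Tape.act {B : Type} (t : Tape B) (s : Option B) (m : Move) : Tape B where
  head := match m with
    | Move.left => t.head - 1
    | Move.stay => t.head
    | Move.right => t.head + 1
  cell := if t.head = 0 then t.cell else Function.update t.cell t.head s

/-- A deterministic Turing machine with a base tape (Tape 0) and `k` additional work tapes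
(Tapes 1, …, k), tape alphabet `B` (plus `⊞` and `⊡`) and state set `Q`. In a state that is not
final, `next` maps the state and the scanned symbols to the new state and, for each tape, to the
symbol to be written and the head movement. -/
structure Machine (k : ℕ) (B Q : Type) where
  start : Q
  final : Q → Bool
  next : Q → Cell B → (Fin k → Cell B) → Q × (Option B × Move) × (Fin k → Option B × Move)

/-- A configuration of a machine. -/
structure Config (k : ℕ) (B Q : Type) where
  state : Q
  base : Tape B
  work : Fin k → Tape B

/-- One step of computation; a configuration in a final state is halted and does not change. -/
def Machine.step {k : ℕ} {B Q : Type} (M : Machine k B Q) (c : Config k B Q) : Config k B Q :=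
  if M.final c.state then c
  else
    let r := M.next c.state c.base.read (fun j => (c.work j).read)
    { state := r.1
      base := c.base.act r.2.1.1 r.2.1.2
      work := fun j => (c.work j).act (r.2.2 j).1 (r.2.2 j).2 }

/-! ### Linear-time learners with additional work tapes -/

/-- The tape alphabet of a learner, for data over `A`, memory over `G` and conjectures over `E`:
letters of the convolution (datum, old memory), letters of the convolution (new memory, conjecture),
and further letters from `W`. -/
inductive Letter (A G E W : Type) where
  | inp (p : Option A × Option G) : Letter A G E W
  | out (p : Option G × Option E) : Letter A G E W
  | work (a : W) : Letter A G E W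

/-- The content of the base tape at the beginning of a cycle. -/
def inputWord {A G E W : Type} (dat : List A) (om : List G) : List (Letter A G E W) :=
  (conv dat om).map Letter.inp

/-- The content of the base tape, up to the first `⊡`, at the end of a cycle. -/
def outputWord {A G E W : Type} (nm : List G) (nc : List E) : List (Letter A G E W) :=
  (conv nm nc).map Letter.out

/-- The configuration at the beginning of a cycle: start state, the convolution of the datum and the
old memory on the base tape, the head of the base tape on `⊞`, and the work tapes, with their heads,
as they were left. -/
def Machine.begin {k : ℕ} {A G E W Q : Type} (M : Machine k (Letter A G E W) Q)
    (dat : List A) (om : List G) (work : Fin k → Tape (Letter A G E W)) :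
    Config k (Letter A G E W) Q where
  state := M.start
  base := Tape.ofWord (inputWord dat om)
  work := work

/-- The length of the longest of the data `w 0, …, w n`. -/
def longest {A : Type} (w : ℕ → List A) (n : ℕ) : ℕ :=
  (Finset.range (n + 1)).sup fun i => (w i).length

/-- One cycle of the learner `M`, with constant `c`, where `ℓ` is the length of the longest datum
seen so far, the current one included. The machine, started on the datum `dat`, the memory `om` and
work tapes `wk`, halts within a number of steps linear in the length of the base tape, with the new
memory `nm` and the conjecture `nc` on the base tape and with work tapes `wk'`. The new memory and
the conjecture have length at most `ℓ + c`, and the head of the base tape stays within the cells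
`0, …, ℓ + c`. -/
def Machine.Cycle {k : ℕ} {A G E W Q : Type} (M : Machine k (Letter A G E W) Q) (c ℓ : ℕ)
    (dat : List A) (om : List G) (wk : Fin k → Tape (Letter A G E W))
    (nm : List G) (nc : List E) (wk' : Fin k → Tape (Letter A G E W)) : Prop :=
  (∃ t ≤ c * ((conv dat om).length + 1),
    M.final (M.step^[t] (M.begin dat om wk)).state = true ∧
    (M.step^[t] (M.begin dat om wk)).base.Holds (outputWord nm nc) ∧
    (M.step^[t] (M.begin dat om wk)).work = wk') ∧
  (conv nm nc).length ≤ ℓ + c ∧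
  ∀ s, (M.step^[s] (M.begin dat om wk)).base.head ≤ ℓ + c

/-- The class `{L e : e ∈ I}` is learnt by some linear-time learner with `k` additional work tapes
that uses the hypothesis space `{H d : d ∈ J}`. Memory alphabet `G`, auxiliary alphabet `W`, state
set `Q`, machine `M`, initial memory `m₀` and constant `c` are fixed once and for all; the work tapes
are empty in the beginning. The resource bounds hold on every sequence of data; on every text of a
language of the class all conjectures are indices, and they converge to an index of that language. -/
def HasLinearTimeLearner {A D E : Type} (k : ℕ) (J : Set (List E)) (H : List E → Set (List A))
    (I : Set (List D)) (L : List D → Set (List A)) : Prop :=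
  ∃ (G W Q : Type) (_ : Finite G) (_ : Finite W) (_ : Finite Q)
    (M : Machine k (Letter A G E W) Q) (m₀ : List G) (c : ℕ),
    ∀ w : ℕ → List A,
      ∃ (mem : ℕ → List G) (hyp : ℕ → List E) (wk : ℕ → Fin k → Tape (Letter A G E W)),
        mem 0 = m₀ ∧
        wk 0 = (fun _ => Tape.ofWord []) ∧
        (∀ n, M.Cycle c (longest w n) (w n) (mem n) (wk n) (mem (n + 1)) (hyp n) (wk (n + 1))) ∧
        ∀ e ∈ I, IsText w (L e) → (∀ n, hyp n ∈ J) ∧ ConvergesTo J H hyp (L e)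

/-! ### The family -/

/-- The set `{0,1}*` of binary words, as a set of words over `{0,1,2}`. -/
def binaryWords : Set (List (Fin 3)) :=
  {x | ∀ a ∈ x, a = 0 ∨ a = 1}

/-- The languages `L_ε = {0,1}*`, `L_{x0} = ({0,1}* ∪ {x2}) - {x}` and `L_{x1} = {0,1}* ∪ {x2}`.
The index set is `binaryWords`. -/
def lang (e : List (Fin 3)) : Set (List (Fin 3)) :=
  if e = [] then binaryWords
  else if e.getLast? = some 0 then (binaryWords ∪ {e.dropLast ++ [2]}) \ {e.dropLast}
  else binaryWords ∪ {e.dropLast ++ [2]}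

theorem lang_nil : lang [] = binaryWords := by
  simp [lang]

theorem lang_append_zero (x : List (Fin 3)) :
    lang (x ++ [0]) = (binaryWords ∪ {x ++ [2]}) \ {x} := by
  simp [lang]

theorem lang_append_one (x : List (Fin 3)) :
    lang (x ++ [1]) = binaryWords ∪ {x ++ [2]} := by
  simp [lang]

end AutomaticLearning

open AutomaticLearning

namespace AutomaticLearning

/-! ### Convolutions, letter by letter -/

/-! Automaticity: stripping a common first letter from index and word preserves `x ∈ lang e`
(`cons_mem_lang_cons`), so a finite automaton only has to remember whether the two words still agree
and, if not, how they parted.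

No automatic learner: the crux is to remember whether `x` occurred before `x2` shows up. By pumping,
an automatic map makes the new memory at most a constant `c` longer than memory and datum
(`IsAutomaticMap.exists_length_le`), so after `m` data of length about `p` the memory has length at
most `p + O(1)` for fixed `m`. With `g = |G| + 1` there are at most `g ^ (p + O(1)) ≤ 2 ^ (g * p +
O(1))` such memories, but `2 ^ (p * m)` sequences of `m` words carrying `p` free bits each. For `m =
g + 1` and large `p`, two sequences lead to the same memory although some `x` occurs in only one of
them. Continue both with the same enumeration of `L_{x0}`: one becomes a text for `L_{x1}`, the
other for `L_{x0}`, yet from then on the conjectures coincide.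

Linear-time learner: the work tape is an unbounded stack. Until some `x2` arrives every datum is
pushed, and the conjecture is `ε`. Then `x` becomes the memory, together with a flag, initially
false. Each later cycle compares `x` with the datum and pops one symbol of the stack; if that is a
separator, the entry below it is compared with `x` up to the first mismatch. A cycle thus costs
`O(|x|)` steps and shortens a nonempty stack, so after finitely many cycles every stored entry has
been tested (`exists_searchStack_eq`, `exists_knowledgeAt_eq_some`). The conjecture is `x0` while
the flag is false and `x1` afterwards. The simulation by the machine is `exists_learner_reaches`;
the limit behaviour is `converges_of_text`. -/

@[simp]
theorem conv_nil_nil {A B : Type} : conv ([] : List A) ([] : List B) = [] := by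
  simp [conv]

@[simp]
theorem conv_cons_cons {A B : Type} (a : A) (b : B) (x : List A) (y : List B) :
    conv (a :: x) (b :: y) = (some a, some b) :: conv x y := by
  rw [conv, conv, List.length_cons, List.length_cons, Nat.succ_max_succ, List.range_succ_eq_map,
    List.map_cons, List.map_map]
  rfl

@[simp]
theorem conv_cons_nil {A B : Type} (a : A) (x : List A) :
    conv (a :: x) ([] : List B) = (some a, none) :: conv x [] := by
  rw [conv, conv, List.length_cons, List.length_nil, Nat.max_zero, Nat.max_zero,
    List.range_succ_eq_map, List.map_cons, List.map_map]
  rfl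

@[simp]
theorem conv_nil_cons {A B : Type} (b : B) (y : List B) :
    conv ([] : List A) (b :: y) = (none, some b) :: conv [] y := by
  rw [conv, conv, List.length_cons, List.length_nil, Nat.zero_max, Nat.zero_max,
    List.range_succ_eq_map, List.map_cons, List.map_map]
  rfl

@[simp]
theorem length_conv {A B : Type} (x : List A) (y : List B) :
    (conv x y).length = max x.length y.length := by
  simp [conv]

theorem nil_eq_conv {A B : Type} {x : List A} {y : List B} :
    [] = conv x y ↔ x = [] ∧ y = [] := by
  cases x <;> cases y <;> simp

theorem some_some_cons_eq_conv {A B : Type} {a : A} {b : B} {u : List (Option A × Option B)}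
    {x : List A} {y : List B} : (some a, some b) :: u = conv x y ↔
      ∃ x' y', x = a :: x' ∧ y = b :: y' ∧ u = conv x' y' := by
  cases x <;> cases y <;> grind [conv_nil_nil, conv_cons_cons, conv_cons_nil, conv_nil_cons]

theorem some_none_cons_eq_conv {A B : Type} {a : A} {u : List (Option A × Option B)}
    {x : List A} {y : List B} : (some a, none) :: u = conv x y ↔
      ∃ x', x = a :: x' ∧ y = [] ∧ u = conv x' [] := by
  cases x <;> cases y <;> grind [conv_nil_nil, conv_cons_cons, conv_cons_nil, conv_nil_cons]

theorem none_some_cons_eq_conv {A B : Type} {b : B} {u : List (Option A × Option B)}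
    {x : List A} {y : List B} : (none, some b) :: u = conv x y ↔
      ∃ y', x = [] ∧ y = b :: y' ∧ u = conv [] y' := by
  cases x <;> cases y <;> grind [conv_nil_nil, conv_cons_cons, conv_cons_nil, conv_nil_cons]

theorem none_none_cons_ne_conv {A B : Type} {u : List (Option A × Option B)}
    {x : List A} {y : List B} : (none, none) :: u ≠ conv x y := by
  cases x <;> cases y <;> simp

/-- A deterministic automaton over pairs recognises a set of convolutions as soon as its states can
be labelled with relations that are compatible with its transitions. -/
theorem _root_.DFA.mem_acceptsFrom_iff_exists_conv {A B σ : Type}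
    (M : DFA (Option A × Option B) σ) (P : σ → List A → List B → Prop)
    (hnil : ∀ s, s ∈ M.accept ↔ P s [] [])
    (hss : ∀ s a b x y, P (M.step s (some a, some b)) x y ↔ P s (a :: x) (b :: y))
    (hsn : ∀ s a x y, P (M.step s (some a, none)) x y ↔ y = [] ∧ P s (a :: x) [])
    (hns : ∀ s b x y, P (M.step s (none, some b)) x y ↔ x = [] ∧ P s [] (b :: y))
    (hnn : ∀ s x y, ¬ P (M.step s (none, none)) x y) (u : List (Option A × Option B)) (s : σ) :
    u ∈ M.acceptsFrom s ↔ ∃ x y, P s x y ∧ u = conv x y := by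
  induction u generalizing s with
  | nil =>
    simp only [DFA.mem_acceptsFrom, DFA.evalFrom_nil, hnil, nil_eq_conv]
    exact ⟨fun h => ⟨_, _, h, rfl, rfl⟩, fun ⟨_, _, h, h1, h2⟩ => h1 ▸ h2 ▸ h⟩
  | cons p u ih =>
    have h : p :: u ∈ M.acceptsFrom s ↔ u ∈ M.acceptsFrom (M.step s p) := Iff.rfl
    rw [h, ih]
    rcases p with ⟨_ | a, _ | b⟩
    · simp [hnn, none_none_cons_ne_conv]
    · simp only [hns, none_some_cons_eq_conv]
      constructor
      · rintro ⟨_, y, ⟨rfl, h⟩, hu⟩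
        exact ⟨_, _, h, y, rfl, rfl, hu⟩
      · rintro ⟨_, _, h, y, rfl, rfl, hu⟩
        exact ⟨_, _, ⟨rfl, h⟩, hu⟩
    · simp only [hsn, some_none_cons_eq_conv]
      constructor
      · rintro ⟨x, _, ⟨rfl, h⟩, hu⟩
        exact ⟨_, _, h, x, rfl, rfl, hu⟩
      · rintro ⟨_, _, h, x, rfl, rfl, hu⟩
        exact ⟨_, _, ⟨rfl, h⟩, hu⟩
    · simp only [hss, some_some_cons_eq_conv]
      constructor
      · rintro ⟨x, y, h, hu⟩
        exact ⟨_, _, h, x, y, rfl, rfl, hu⟩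
      · rintro ⟨_, _, h, x, y, rfl, rfl, hu⟩
        exact ⟨_, _, h, hu⟩

/-! ### The family is automatic -/

@[simp]
theorem nil_mem_binaryWords : [] ∈ binaryWords := by
  simp [binaryWords]

@[simp]
theorem cons_mem_binaryWords {a : Fin 3} {x : List (Fin 3)} :
    a :: x ∈ binaryWords ↔ (a = 0 ∨ a = 1) ∧ x ∈ binaryWords := by
  simp [binaryWords]

@[simp]
theorem append_mem_binaryWords {x y : List (Fin 3)} :
    x ++ y ∈ binaryWords ↔ x ∈ binaryWords ∧ y ∈ binaryWords := by
  simp [binaryWords, or_imp, forall_and]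

theorem isRegularSet_binaryWords : IsRegularSet binaryWords := by
  let M : DFA (Fin 3) Bool :=
    { step := fun s a => s && (a = 0 ∨ a = 1), start := true, accept := {true} }
  refine ⟨Bool, inferInstance, M, ?_⟩
  have h : ∀ (x : List (Fin 3)) s, M.evalFrom s x = true ↔ s = true ∧ x ∈ binaryWords := by
    intro x
    induction x with
    | nil => simp
    | cons a x ih =>
      intro s
      rw [DFA.evalFrom_cons, ih]
      simp [M, and_assoc]
  ext x
  exact (h x true).trans (and_iff_right rfl)

/-- The states of an automaton that reads the convolution of an index and a word: so far the two
are equal (`same`); they differ, and both or one of them may continue (`apart`, `indexOnly`,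
`wordOnly`); the index is `xa` and the word is `x2` (`marked`) or `x` (`short0` if `a = 0`, and
`short1` if `a = 1`); or the input is illegal (`dead`). -/
inductive FamilyState
  | same | apart | indexOnly | wordOnly | marked | short0 | short1 | dead
  deriving DecidableEq

instance : Fintype FamilyState where
  elems := {.same, .apart, .indexOnly, .wordOnly, .marked, .short0, .short1, .dead}
  complete s := by cases s <;> simp

/-- The transitions of the automaton for the family. -/
def FamilyState.step : FamilyState → Option (Fin 3) × Option (Fin 3) → FamilyState
  | same, (some a, some b) =>
    if a = 2 then dead else if b = 2 then marked else if a = b then same else apart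
  | same, (some a, none) => if a = 0 then short0 else if a = 1 then short1 else dead
  | same, (none, some b) => if b = 2 then dead else wordOnly
  | apart, (some a, some b) => if a = 2 ∨ b = 2 then dead else apart
  | apart, (some a, none) => if a = 2 then dead else indexOnly
  | apart, (none, some b) => if b = 2 then dead else wordOnly
  | indexOnly, (some a, none) => if a = 2 then dead else indexOnly
  | wordOnly, (none, some b) => if b = 2 then dead else wordOnly
  | short0, (some a, none) => if a = 2 then dead else indexOnly
  | short1, (some a, none) => if a = 2 then dead else indexOnly
  | _, _ => dead

/-- What may still be read, as index and as word, from the given state. -/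
def FamilyState.Residual : FamilyState → List (Fin 3) → List (Fin 3) → Prop
  | same, e, x => e ∈ binaryWords ∧ x ∈ lang e
  | apart, e, x => e ∈ binaryWords ∧ x ∈ binaryWords
  | indexOnly, e, x => e ∈ binaryWords ∧ x = []
  | wordOnly, e, x => e = [] ∧ x ∈ binaryWords
  | marked, e, x => e = [] ∧ x = []
  | short0, e, x => e ∈ binaryWords ∧ e ≠ [] ∧ x = []
  | short1, e, x => e ∈ binaryWords ∧ x = []
  | dead, _, _ => False

/-- The automaton for the family. -/
def familyDFA : DFA (Option (Fin 3) × Option (Fin 3)) FamilyState where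
  step := FamilyState.step
  start := .same
  accept := {s | s ≠ .short0 ∧ s ≠ .dead}

/-- The self-similarity behind the automaton: equal first letters leave the same problem for the
rests, and different ones leave only the question whether the word is binary, except for a `2`
facing the last letter of the index. -/
theorem cons_mem_lang_cons {a b : Fin 3} {e x : List (Fin 3)} (ha : a = 0 ∨ a = 1) :
    b :: x ∈ lang (a :: e) ↔ (b = a ∧ x ∈ lang e) ∨ (b ≠ a ∧ b ≠ 2 ∧ x ∈ binaryWords) ∨
      (b = 2 ∧ e = [] ∧ x = []) := by
  cases e with
  | nil => rcases ha with rfl | rfl <;> fin_cases b <;> simp [lang]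
  | cons c e =>
    have h1 : (a :: c :: e).getLast? = (c :: e).getLast? := by simp
    have h2 : (a :: c :: e).dropLast = a :: (c :: e).dropLast := by simp
    unfold lang
    rw [h1, h2]
    split_ifs <;> rcases ha with rfl | rfl <;> fin_cases b <;> simp_all

theorem nil_mem_lang_cons {a : Fin 3} {e : List (Fin 3)} :
    [] ∈ lang (a :: e) ↔ a ≠ 0 ∨ e ≠ [] := by
  cases e with
  | nil => fin_cases a <;> simp [lang]
  | cons c e => simp [lang]; split_ifs <;> simp

theorem mem_accepts_familyDFA (u : List (Option (Fin 3) × Option (Fin 3))) :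
    u ∈ familyDFA.accepts ↔ ∃ e x, (e ∈ binaryWords ∧ x ∈ lang e) ∧ u = conv e x := by
  refine familyDFA.mem_acceptsFrom_iff_exists_conv FamilyState.Residual ?_ ?_ ?_ ?_ ?_ u .same
  · intro s
    cases s <;> simp [familyDFA, FamilyState.Residual, lang_nil]
  · intro s a b x y
    cases s <;> fin_cases a <;> fin_cases b <;>
      simp [familyDFA, FamilyState.step, FamilyState.Residual, cons_mem_lang_cons] <;>
      (rintro rfl -; simp)
  · intro s a x y
    cases s <;> fin_cases a <;>
      simp [familyDFA, FamilyState.step, FamilyState.Residual, nil_mem_lang_cons] <;>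
      tauto
  · intro s b x y
    cases s <;> fin_cases b <;>
      simp [familyDFA, FamilyState.step, FamilyState.Residual, lang_nil]
  · intro s x y
    cases s <;> simp [familyDFA, FamilyState.step, FamilyState.Residual]

theorem isAutomaticFamily_lang : IsAutomaticFamily binaryWords lang := by
  refine ⟨isRegularSet_binaryWords, FamilyState, inferInstance, familyDFA, ?_⟩
  ext u
  rw [mem_accepts_familyDFA]
  exact ⟨fun ⟨e, x, h, hu⟩ => ⟨e, h.1, x, h.2, hu⟩, fun ⟨e, he, x, hx, hu⟩ => ⟨e, x, ⟨he, hx⟩, hu⟩⟩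

/-! ### The memory of an automatic learner grows slowly -/

theorem filterMap_getElem?_range {A : Type} (x : List A) {n : ℕ} (hn : x.length ≤ n) :
    (List.range n).filterMap (fun i => x[i]?) = x := by
  induction x generalizing n with
  | nil => simp
  | cons a x ih =>
    obtain ⟨n, rfl⟩ : ∃ k, n = k + 1 := ⟨n - 1, by simp at hn; omega⟩
    simp only [List.range_succ_eq_map, List.filterMap_cons, List.getElem?_cons_zero,
      List.filterMap_map]
    congr 1
    exact ih (by simpa using hn)

/-- Deleting the padding from a track recovers its word. This identifies the old memory and the
datum after a convolution has been pumped down. -/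
theorem filterMap_fst_conv₄ {A B C D : Type} (x : List A) (y : List B) (z : List C) (u : List D) :
    (conv₄ x y z u).filterMap (fun q => q.1) = x := by
  rw [conv₄, List.filterMap_map]
  exact filterMap_getElem?_range x (by omega)

theorem filterMap_snd_conv₄ {A B C D : Type} (x : List A) (y : List B) (z : List C) (u : List D) :
    (conv₄ x y z u).filterMap (fun q => q.2.1) = y := by
  rw [conv₄, List.filterMap_map]
  exact filterMap_getElem?_range y (by omega)

theorem eq_none_of_mem_drop_conv₄ {A B C D : Type} {x : List A} {y : List B} {z : List C}
    {u : List D} {n : ℕ} (hx : x.length ≤ n) (hy : y.length ≤ n)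
    {q : Option A × Option B × Option C × Option D} (hq : q ∈ (conv₄ x y z u).drop n) :
    q.1 = none ∧ q.2.1 = none := by
  obtain ⟨i, hi, rfl⟩ := List.mem_iff_getElem.1 hq
  simp only [conv₄, List.getElem_drop, List.getElem_map, List.getElem_range]
  exact ⟨List.getElem?_eq_none (by omega), List.getElem?_eq_none (by omega)⟩

/-- Were the output much longer than the input, a loop of the automaton could be cut out of the part
where both input tracks are padding. The shorter word is accepted too and encodes the same input,
hence the same output, which contradicts its length. -/
theorem IsAutomaticMap.exists_length_le {A G E : Type}
    {M : List G → List A → Option (List G × List E)} (hM : IsAutomaticMap M) :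
    ∃ c, ∀ om dat nm nc, M om dat = some (nm, nc) →
      nm.length ≤ max om.length dat.length + c := by
  obtain ⟨σ, _, D, hD⟩ := hM
  refine ⟨Fintype.card σ, fun om dat nm nc h => ?_⟩
  by_contra! hlt
  set n := max om.length dat.length
  set u := conv₄ om dat nm nc with hu
  have hlen : n + Fintype.card σ < u.length := by simp only [hu, conv₄]; simp; omega
  have hacc : u ∈ D.accepts := hD ▸ ⟨om, dat, nm, nc, h, rfl⟩
  -- Pumping applied to the run on the tail only: `b` is a nonempty loop lying beyond both input
  -- words.
  obtain ⟨q, a, b, c, hv, -, hb, ha', hb', hc'⟩ :=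
    D.evalFrom_split (s := D.evalFrom D.start (u.take n)) (x := u.drop n)
      (by rw [List.length_drop]; omega) rfl
  have hacc' : u.take n ++ (a ++ c) ∈ D.accepts := by
    have : D.evalFrom D.start (u.take n ++ (a ++ c)) = D.evalFrom D.start u := by
      rw [D.evalFrom_of_append, D.evalFrom_of_append, ha', hc', ← D.evalFrom_of_append,
        List.take_append_drop]
    rwa [D.mem_accepts, DFA.eval, this]
  rw [hD] at hacc'
  obtain ⟨om', dat', nm', nc', h', hu'⟩ := hacc'
  have hnone : ∀ q ∈ a ++ b ++ c, q.1 = none ∧ q.2.1 = none := fun q hq =>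
    eq_none_of_mem_drop_conv₄ (le_max_left _ _) (le_max_right _ _) (hv ▸ hq)
  have hnone' : ∀ q ∈ a ++ c, q.1 = none ∧ q.2.1 = none := fun q hq =>
    hnone q (by simp only [List.mem_append] at hq ⊢; tauto)
  have hom : om' = om := by
    have h1 := filterMap_fst_conv₄ om' dat' nm' nc'
    have h2 := filterMap_fst_conv₄ om dat nm nc
    rw [← hu', List.filterMap_append, List.filterMap_eq_nil_iff.2 fun q hq => (hnone' q hq).1] at h1
    rw [← hu, ← List.take_append_drop n u, hv, List.filterMap_append,
      List.filterMap_eq_nil_iff.2 fun q hq => (hnone q hq).1] at h2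
    exact h1.symm.trans h2
  have hdat : dat' = dat := by
    have h1 := filterMap_snd_conv₄ om' dat' nm' nc'
    have h2 := filterMap_snd_conv₄ om dat nm nc
    rw [← hu', List.filterMap_append, List.filterMap_eq_nil_iff.2 fun q hq => (hnone' q hq).2] at h1
    rw [← hu, ← List.take_append_drop n u, hv, List.filterMap_append,
      List.filterMap_eq_nil_iff.2 fun q hq => (hnone q hq).2] at h2
    exact h1.symm.trans h2
  subst hom hdat
  rw [h'] at h
  obtain ⟨rfl, rfl⟩ : nm' = nm ∧ nc' = nc := by simpa using h
  have := congrArg List.length (hu'.trans (List.take_append_drop n u).symm)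
  have hb0 := List.length_pos_of_ne_nil hb
  simp only [hv, List.length_append] at this
  omega

/-- If one step adds at most `c` letters to the longer one of memory and datum, then `n` data of
length at most `b` lead to a memory of length at most `max |m₀| b + c n`. -/
theorem length_mem_le {A G E : Type} {M : List G → List A → Option (List G × List E)} {c : ℕ}
    (hc : ∀ om dat nm nc, M om dat = some (nm, nc) → nm.length ≤ max om.length dat.length + c)
    {w : ℕ → List A} {mem : ℕ → List G} {hyp : ℕ → List E}
    (hrun : ∀ n, M (mem n) (w n) = some (mem (n + 1), hyp n)) {b n : ℕ}
    (hb : ∀ i < n, (w i).length ≤ b) : (mem n).length ≤ max (mem 0).length b + c * n := by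
  induction n with
  | zero => simp
  | succ n ih =>
    have h1 := hc _ _ _ _ (hrun n)
    have h2 := ih fun i hi => hb i (by omega)
    have h3 := hb n (by omega)
    rw [mul_add, mul_one]
    omega

/-- Since `M` is single-valued, runs that meet and read the same data stay together. This is needed
because a run is supplied separately for each index and text. -/
theorem mem_eq_of_forall_lt {A G E : Type} {M : List G → List A → Option (List G × List E)}
    {w w' : ℕ → List A} {mem mem' : ℕ → List G} {hyp hyp' : ℕ → List E}
    (hrun : ∀ n, M (mem n) (w n) = some (mem (n + 1), hyp n))
    (hrun' : ∀ n, M (mem' n) (w' n) = some (mem' (n + 1), hyp' n))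
    {k n : ℕ} (hk : mem k = mem' k) (hkn : k ≤ n) (hw : ∀ i, k ≤ i → i < n → w i = w' i) :
    mem n = mem' n := by
  induction n, hkn using Nat.le_induction with
  | base => exact hk
  | succ n hkn ih =>
    have h1 := hrun n
    rw [ih fun i hi hi' => hw i hi (by omega), hw n hkn (by omega), hrun' n] at h1
    simp only [Option.some.injEq, Prod.mk.injEq] at h1
    exact h1.1.symm

/-! ### Many short sequences of data -/

/-- The word `0ⁱ 1 y`. -/
def codeWord (i : ℕ) {p : ℕ} (y : Fin p → Bool) : List (Fin 3) :=
  List.replicate i 0 ++ 1 :: List.ofFn fun j => if y j then 1 else 0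

theorem length_codeWord (i : ℕ) {p : ℕ} (y : Fin p → Bool) :
    (codeWord i y).length = i + (p + 1) := by
  simp [codeWord]

theorem codeWord_mem_binaryWords (i : ℕ) {p : ℕ} (y : Fin p → Bool) :
    codeWord i y ∈ binaryWords := by
  simp only [codeWord, append_mem_binaryWords, cons_mem_binaryWords]
  refine ⟨fun a ha => Or.inl (List.eq_of_mem_replicate ha), by simp, fun a ha => ?_⟩
  obtain ⟨j, rfl⟩ := List.mem_ofFn.1 ha
  split_ifs <;> simp

/-- The first `1` marks the slot `i`, so a word from slot `i` of one sequence cannot reappear in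
another slot of a different sequence. -/
theorem codeWord_injective {i j p : ℕ} {y z : Fin p → Bool} (h : codeWord i y = codeWord j z) :
    i = j ∧ y = z := by
  have key : ∀ (i j : ℕ) (u v : List (Fin 3)),
      List.replicate i 0 ++ 1 :: u = List.replicate j 0 ++ 1 :: v → i = j ∧ u = v := by
    intro i
    induction i with
    | zero => intro j u v; cases j <;> simp [List.replicate_succ]
    | succ i ih =>
      intro j u v
      cases j with
      | zero => simp [List.replicate_succ]
      | succ j => simpa [List.replicate_succ] using ih j u v
  obtain ⟨rfl, h'⟩ := key _ _ _ _ h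
  refine ⟨rfl, funext fun k => ?_⟩
  have := congrFun (List.ofFn_injective h') k
  cases hy : y k <;> cases hz : z k <;> simp_all

/-- The sequence that starts with `f 0, …, f (m - 1)` and goes on as `s`. -/
def prepend {α : Type} {m : ℕ} (f : Fin m → α) (s : ℕ → α) (n : ℕ) : α :=
  if h : n < m then f ⟨n, h⟩ else s (n - m)

theorem range_prepend {α : Type} {m : ℕ} (f : Fin m → α) (s : ℕ → α) :
    Set.range (prepend f s) = Set.range f ∪ Set.range s := by
  ext a
  constructor
  · rintro ⟨n, rfl⟩
    unfold prepend
    split_ifs with h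
    · exact Or.inl ⟨_, rfl⟩
    · exact Or.inr ⟨_, rfl⟩
  · rintro (⟨i, rfl⟩ | ⟨n, rfl⟩)
    · exact ⟨i, by simp [prepend]⟩
    · exact ⟨n + m, by simp [prepend]⟩

/-- Pigeonhole: a word of length at most `n`, padded with `none`, is a function `Fin n → Option G`,
and there are `(|G| + 1) ^ n` of these. -/
theorem exists_ne_of_length_le {G X : Type} [Finite G] [Finite X] (μ : X → List G) {n : ℕ}
    (hμ : ∀ x, (μ x).length ≤ n) (hcard : (Nat.card G + 1) ^ n < Nat.card X) :
    ∃ x y, x ≠ y ∧ μ x = μ y := by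
  have : ¬ Function.Injective fun (x : X) (i : Fin n) => (μ x)[(i : ℕ)]? := by
    intro h
    have := Nat.card_le_card_of_injective _ h
    rw [Nat.card_fun, Finite.card_option, Nat.card_fin] at this
    omega
  simp only [Function.Injective, not_forall] at this
  obtain ⟨x, y, h, hxy⟩ := this
  refine ⟨x, y, hxy, List.ext_getElem? fun i => ?_⟩
  by_cases hi : i < n
  · exact congrFun h ⟨i, hi⟩
  · rw [List.getElem?_eq_none, List.getElem?_eq_none] <;> grind

/-! ### There is no automatic learner -/

theorem not_hasAutomaticLearner_lang {E : Type} (J : Set (List E))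
    (H : List E → Set (List (Fin 3))) : ¬ HasAutomaticLearner J H binaryWords lang := by
  rintro ⟨G, _, M, m₀, hM, hlearn⟩
  obtain ⟨c, hc⟩ := hM.exists_length_le
  choose! mem hyp hmem₀ hrun hconv using hlearn
  set g := Nat.card G + 1 with hg
  set m := g + 1 with hm
  -- Chosen so that `g * (m₀.length + m + 1 + c * m + p) = (p - 1) + g * p < p * m`, which is the
  -- comparison of exponents below.
  set p := g * (m₀.length + m + 1 + c * m) + 1 with hp
  obtain ⟨s₀, hs₀⟩ := binaryWords.to_countable.exists_eq_range ⟨[], nil_mem_binaryWords⟩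
  let pre (y : Fin m → Fin p → Bool) (i : Fin m) : List (Fin 3) := codeWord i (y i)
  have hpre : ∀ y, Set.range (pre y) ⊆ binaryWords := by
    rintro y _ ⟨i, rfl⟩
    exact codeWord_mem_binaryWords _ _
  -- Runs exist only along texts of the class, so every prefix is first completed to a text for
  -- `L_ε` in order to speak of its memory.
  have htext : ∀ y, IsText (prepend (pre y) s₀) (lang []) := by
    intro y
    rw [IsText, range_prepend, ← hs₀, lang_nil, Set.union_eq_right]
    exact hpre y
  have hprelen : ∀ y s i, i < m → (prepend (pre y) s i).length ≤ m + (p + 1) := by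
    intro y s i hi
    simp only [prepend, hi, dif_pos, pre, length_codeWord]
    omega
  obtain ⟨y, z, hyz, hμ⟩ := exists_ne_of_length_le
    (fun y => mem [] (prepend (pre y) s₀) m) (n := max m₀.length (m + (p + 1)) + c * m)
    (fun y => by
      have := length_mem_le hc (hrun [] nil_mem_binaryWords _ (htext y)) (hprelen y s₀)
      rwa [hmem₀ [] nil_mem_binaryWords _ (htext y)] at this)
    (by
      rw [← hg, Nat.card_fun, Nat.card_fun, Nat.card_fin, Nat.card_fin, ← pow_mul]
      calc g ^ (max m₀.length (m + (p + 1)) + c * m)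
          ≤ (2 ^ g) ^ (max m₀.length (m + (p + 1)) + c * m) :=
            Nat.pow_le_pow_left Nat.lt_two_pow_self.le _
        _ = 2 ^ (g * (max m₀.length (m + (p + 1)) + c * m)) := (pow_mul _ _ _).symm
        _ < (Nat.card Bool) ^ (p * m) := by
          rw [Nat.card_eq_fintype_card, Fintype.card_bool]
          refine Nat.pow_lt_pow_right one_lt_two ?_
          calc _ ≤ g * (m₀.length + m + 1 + c * m + p) := Nat.mul_le_mul_left _ (by omega)
            _ < p * m := by
              rw [mul_add, show p * m = g * p + p by rw [hm]; ring]
              linarith)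
  obtain ⟨i, hi⟩ := Function.ne_iff.1 hyz
  set x := pre y i with hx
  have hxb : x ∈ binaryWords := codeWord_mem_binaryWords _ _
  have hxz : x ∉ Set.range (pre z) := by
    rintro ⟨j, hj⟩
    obtain ⟨hji, h⟩ := codeWord_injective hj
    rw [Fin.ext hji] at h
    exact hi h.symm
  obtain ⟨s, hs⟩ := (lang (x ++ [0])).to_countable.exists_eq_range
    ⟨x ++ [2], by simp [lang_append_zero]⟩
  -- The tail `s` lists `L_{x0}`; the prefix from `y` adds exactly the missing word `x`, whereas the
  -- one from `z` adds nothing new.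
  have h1 : IsText (prepend (pre y) s) (lang (x ++ [1])) := by
    rw [IsText, range_prepend, ← hs, lang_append_zero, lang_append_one]
    ext v
    by_cases hv : v = x
    · rw [hv]
      exact ⟨fun _ => Or.inl hxb, fun _ => Or.inl ⟨i, rfl⟩⟩
    · have := @hpre y v
      simp only [Set.mem_union, Set.mem_sdiff, Set.mem_singleton_iff] at *
      tauto
  have h0 : IsText (prepend (pre z) s) (lang (x ++ [0])) := by
    rw [IsText, range_prepend, ← hs, lang_append_zero, Set.union_eq_right]
    exact fun v hv => ⟨Or.inl (hpre z hv), fun h => hxz (h ▸ hv)⟩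
  have hi1 : x ++ [1] ∈ binaryWords := by simp [hxb]
  have hi0 : x ++ [0] ∈ binaryWords := by simp [hxb]
  have hsame : ∀ y s' i, i < m → prepend (pre y) s i = prepend (pre y) s' i := by
    intro y s' i hi
    simp [prepend, hi]
  have hmm : mem (x ++ [1]) (prepend (pre y) s) m = mem (x ++ [0]) (prepend (pre z) s) m := by
    rw [mem_eq_of_forall_lt (hrun _ hi1 _ h1) (hrun [] nil_mem_binaryWords _ (htext y)) (k := 0)
        (by rw [hmem₀ _ hi1 _ h1, hmem₀ [] nil_mem_binaryWords _ (htext y)]) (Nat.zero_le m)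
        fun i _ hi => hsame y s₀ i hi,
      mem_eq_of_forall_lt (hrun _ hi0 _ h0) (hrun [] nil_mem_binaryWords _ (htext z)) (k := 0)
        (by rw [hmem₀ _ hi0 _ h0, hmem₀ [] nil_mem_binaryWords _ (htext z)]) (Nat.zero_le m)
        fun i _ hi => hsame z s₀ i hi]
    exact hμ
  have htail : ∀ n, m ≤ n → prepend (pre y) s n = prepend (pre z) s n := by
    intro n hn
    simp [prepend, hn.not_gt]
  have hhyp : ∀ n, m ≤ n →
      hyp (x ++ [1]) (prepend (pre y) s) n = hyp (x ++ [0]) (prepend (pre z) s) n := by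
    intro n hn
    have e1 := hrun _ hi1 _ h1 n
    rw [mem_eq_of_forall_lt (hrun _ hi1 _ h1) (hrun _ hi0 _ h0) hmm hn
      fun i hi _ => htail i hi, htail n hn, hrun _ hi0 _ h0 n] at e1
    simp only [Option.some.injEq, Prod.mk.injEq] at e1
    exact e1.2.symm
  obtain ⟨n1, -, hL1, hst1⟩ := hconv _ hi1 _ h1
  obtain ⟨n0, -, hL0, hst0⟩ := hconv _ hi0 _ h0
  have hL : lang (x ++ [1]) = lang (x ++ [0]) := by
    rw [← hL1, ← hL0, ← hst1 (max m (max n1 n0)) (by omega),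
      ← hst0 (max m (max n1 n0)) (by omega), hhyp _ (le_max_left _ _)]
  have : x ∈ lang (x ++ [0]) := by rw [← hL, lang_append_one]; exact Or.inl hxb
  rw [lang_append_zero] at this
  exact this.2 rfl

/-! ### Tapes -/

namespace Tape

variable {B : Type}

/-- The tape `⊞ l.reverse r ⊡ ⊡ …` with its head on the first letter of `r`. -/
def focus (l r : List B) : Tape B where
  head := l.length + 1
  cell := fun i => if i = 0 then none else (l.reverse ++ r)[i - 1]?

/-- The tape `focus l r` with its head moved to the left by one cell. -/
def leftOf (l r : List B) : Tape B :=
  match l with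
  | [] => ofWord r
  | a :: l => focus l (a :: r)

@[simp]
theorem head_focus (l r : List B) : (focus l r).head = l.length + 1 :=
  rfl

@[simp]
theorem head_ofWord (u : List B) : (ofWord u).head = 0 :=
  rfl

@[simp]
theorem head_leftOf (l r : List B) : (leftOf l r).head = l.length := by
  cases l <;> rfl

theorem cell_focus_self (l r : List B) : (focus l r).cell (l.length + 1) = r.head? := by
  cases r <;> simp [focus]

@[simp]
theorem read_focus_cons (l r : List B) (b : B) : (focus l (b :: r)).read = Cell.letter b := by
  simp [read, cell_focus_self]

@[simp]
theorem read_focus_nil (l : List B) : (focus l []).read = Cell.blank := by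
  simp [read, cell_focus_self]

@[simp]
theorem read_ofWord (u : List B) : (ofWord u).read = Cell.leftEnd := by
  simp [read]

theorem update_cell_focus (l r : List B) (b b' : B) :
    Function.update (focus l (b :: r)).cell (l.length + 1) (some b') =
      (focus l (b' :: r)).cell := by
  ext1 i
  by_cases hi : i = l.length + 1
  · subst hi; simp [cell_focus_self]
  · rw [Function.update_of_ne hi]
    unfold focus
    dsimp only
    split_ifs with h0
    · rfl
    · rcases lt_or_ge (i - 1) l.length with h | h
      · rw [List.getElem?_append_left (by simpa using h),
          List.getElem?_append_left (by simpa using h)]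
      · obtain ⟨j, rfl⟩ : ∃ j, i = l.length + 1 + j + 1 := ⟨i - (l.length + 1) - 1, by omega⟩
        rw [List.getElem?_append_right (by simp; omega),
          List.getElem?_append_right (by simp; omega)]
        have : l.length + 1 + j + 1 - 1 - l.reverse.length = j + 1 := by simp; omega
        rw [this]
        rfl

/-- The bound on `r` covers both uses of a written blank: erasing the last letter of the tape, and
rewriting a cell that is already empty. -/
theorem update_cell_focus_none (l r : List B) (hr : r.length ≤ 1) :
    Function.update (focus l r).cell (l.length + 1) none = (focus l []).cell := by
  ext1 i
  by_cases hi : i = l.length + 1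
  · subst hi; simp [cell_focus_self]
  · rw [Function.update_of_ne hi]
    unfold focus
    dsimp only
    split_ifs with h0
    · rfl
    · rcases lt_or_ge (i - 1) l.length with h | h
      · rw [List.getElem?_append_left (by simpa using h),
          List.getElem?_append_left (by simpa using h)]
      · rw [List.getElem?_eq_none (by simp; omega), List.getElem?_eq_none (by simp; omega)]

theorem cell_leftOf (l r : List B) : (leftOf l r).cell = (focus l r).cell := by
  cases l <;> simp [leftOf, focus, ofWord]

theorem ext_of {t t' : Tape B} (h : t.head = t'.head) (h' : t.cell = t'.cell) : t = t' := by
  cases t; cases t'; simp_all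

theorem act_focus_right (l r : List B) (b b' : B) :
    (focus l (b :: r)).act (some b') Move.right = focus (b' :: l) r := by
  refine ext_of rfl ?_
  simp only [act, head_focus, Nat.add_one_ne_zero, if_false, update_cell_focus]
  simp [focus]

theorem act_focus_stay (l r : List B) (b b' : B) :
    (focus l (b :: r)).act (some b') Move.stay = focus l (b' :: r) := by
  refine ext_of rfl ?_
  simp only [act, head_focus, Nat.add_one_ne_zero, if_false, update_cell_focus]

theorem act_focus_left (l r : List B) (b b' : B) :
    (focus l (b :: r)).act (some b') Move.left = leftOf l (b' :: r) := by
  refine ext_of (by simp [act]) ?_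
  simp only [act, head_focus, Nat.add_one_ne_zero, if_false, update_cell_focus, cell_leftOf]

theorem act_focus_none_left (l r : List B) (hr : r.length ≤ 1) :
    (focus l r).act none Move.left = leftOf l [] := by
  refine ext_of (by simp [act]) ?_
  simp only [act, head_focus, Nat.add_one_ne_zero, if_false, update_cell_focus_none l r hr,
    cell_leftOf]

theorem act_ofWord_right (u : List B) (s : Option B) :
    (ofWord u).act s Move.right = focus [] u := by
  refine ext_of rfl ?_
  simp [act, focus, ofWord]

theorem act_ofWord_stay (u : List B) (s : Option B) : (ofWord u).act s Move.stay = ofWord u :=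
  rfl

theorem holds_ofWord (u : List B) : (ofWord u).Holds u := by
  intro i _
  simp [ofWord]

/-- One blank after the output suffices to discard whatever remains of a longer input, because
`Holds` ignores the cells beyond it. -/
theorem holds_act_focus_none_stay (l r : List B) :
    ((focus l r).act none Move.stay).Holds l.reverse := by
  intro i hi
  rw [List.length_reverse] at hi
  simp only [act, head_focus, Nat.add_one_ne_zero, if_false]
  rcases hi.lt_or_eq with h | rfl
  · rw [Function.update_of_ne (by omega)]
    rw [← List.getElem?_append_left (l₂ := r) (by simpa using h)]
    rfl
  · simp

end Tape

/-- What has to be written in order not to change the cell. -/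
def Cell.keep {B : Type} : Cell B → Option B
  | .letter b => some b
  | _ => none

theorem Tape.act_keep {B : Type} (t : Tape B) (m : Move) :
    (t.act t.read.keep m).cell = t.cell := by
  unfold Tape.act Tape.read
  by_cases h : t.head = 0
  · simp [h]
  · cases h' : t.cell t.head <;> simp [h, h', Cell.keep, Function.update_eq_self_iff]

theorem Tape.act_keep_stay {B : Type} (t : Tape B) : t.act t.read.keep Move.stay = t :=
  Tape.ext_of rfl (t.act_keep _)

/-! ### Runs of a machine that keep the head of the base tape in a bounded region -/

/-- The machine gets from `c` to `c'` in `t` steps, the head of the base tape staying in the cells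
`0, …, N`. -/
def Machine.Reaches {k : ℕ} {B Q : Type} (M : Machine k B Q) (N : ℕ) (c : Config k B Q) (t : ℕ)
    (c' : Config k B Q) : Prop :=
  M.step^[t] c = c' ∧ ∀ s ≤ t, (M.step^[s] c).base.head ≤ N

namespace Machine.Reaches

variable {k : ℕ} {B Q : Type} {M : Machine k B Q} {N : ℕ} {c c' c'' : Config k B Q} {t t' : ℕ}

theorem refl (h : c.base.head ≤ N) : M.Reaches N c 0 c :=
  ⟨rfl, fun s hs => by rwa [Nat.le_zero.1 hs]⟩

theorem mono {N' : ℕ} (h : M.Reaches N c t c') (hN : N ≤ N') : M.Reaches N' c t c' :=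
  ⟨h.1, fun s hs => (h.2 s hs).trans hN⟩

theorem cons (h : c.base.head ≤ N) (h' : M.Reaches N (M.step c) t c') :
    M.Reaches N c (t + 1) c' := by
  refine ⟨h'.1, fun s hs => ?_⟩
  cases s with
  | zero => exact h
  | succ s => exact h'.2 s (by omega)

theorem trans (h : M.Reaches N c t c') (h' : M.Reaches N c' t' c'') :
    M.Reaches N c (t' + t) c'' := by
  refine ⟨by rw [Function.iterate_add_apply, h.1, h'.1], fun s hs => ?_⟩
  rcases le_total s t with hst | hst
  · exact h.2 s hst
  · obtain ⟨d, rfl⟩ := Nat.exists_eq_add_of_le' hst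
    rw [Function.iterate_add_apply, h.1]
    exact h'.2 d (by omega)

/-- A halted configuration is a fixed point of `step`, so the bound extends to all times, as
`Machine.Cycle` demands. -/
theorem head_le (h : M.Reaches N c t c') (hf : M.final c'.state = true) (s : ℕ) :
    (M.step^[s] c).base.head ≤ N := by
  rcases le_total s t with hst | hst
  · exact h.2 s hst
  · obtain ⟨d, rfl⟩ := Nat.exists_eq_add_of_le' hst
    rw [Function.iterate_add_apply, h.1, Function.iterate_fixed (by simp [Machine.step, hf])]
    exact h.1 ▸ h.2 t le_rfl

end Machine.Reaches

/-! ### The learner: its memory, and the stack on its work tape -/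

/-- The memory alphabet: the memory is empty, or `x f`, where the datum `x2` has been seen and `f`
tells whether `x` is known to be among the data. -/
abbrev MemLetter : Type :=
  Fin 3 ⊕ Bool

/-- The symbols that are stored on the work tape: letters, and a separator `none`. -/
abbrev StackLetter : Type :=
  Option (Fin 3)

/-- The tape alphabet of the learner. -/
abbrev TapeLetter : Type :=
  Letter (Fin 3) MemLetter (Fin 3) StackLetter

/-- The memory `x f`. -/
def memo (x : List (Fin 3)) (f : Bool) : List MemLetter :=
  x.map Sum.inl ++ [Sum.inr f]

/-- The last letter of the conjecture `x1` or `x0`. -/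
def bit (f : Bool) : Fin 3 :=
  if f then 1 else 0

/-- Compare `x` with the topmost entry of the stack, until there is a mismatch. -/
def matchStack : List (Fin 3) → List StackLetter → Bool × List StackLetter
  | [], [] => (true, [])
  | [], none :: s => (true, none :: s)
  | [], some a :: s => (false, some a :: s)
  | a :: x, some b :: s => if b = a then matchStack x s else (false, some b :: s)
  | _ :: _, s => (false, s)

/-- Below a separator, compare `x` with the next entry of the stack; otherwise, drop a letter. -/
def searchStack (x : List (Fin 3)) : List StackLetter → Bool × List StackLetter
  | none :: s => matchStack x s
  | _ :: s => (false, s)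
  | [] => (false, [])

/-- The cells `s.length, …, 1` contain the stack `s`. -/
def Stacked (f : ℕ → Option TapeLetter) : List StackLetter → Prop
  | [] => True
  | a :: s => f (s.length + 1) = some (Letter.work a) ∧ Stacked f s

/-- The head is on the top of the stack `s`. -/
def HasStack (t : Tape TapeLetter) (s : List StackLetter) : Prop :=
  t.head = s.length ∧ Stacked t.cell s

/-- The head is on the cell above the stack `s`. -/
def AboveStack (t : Tape TapeLetter) (s : List StackLetter) : Prop :=
  t.head = s.length + 1 ∧ Stacked t.cell s

theorem Stacked.update {f : ℕ → Option TapeLetter} {s : List StackLetter} (h : Stacked f s)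
    {n : ℕ} (hn : s.length < n) (b : Option TapeLetter) : Stacked (Function.update f n b) s := by
  induction s with
  | nil => trivial
  | cons a s ih =>
    rw [List.length_cons] at hn
    exact ⟨by rw [Function.update_of_ne (by omega)]; exact h.1, ih h.2 (by omega)⟩

theorem HasStack.read_nil {t : Tape TapeLetter} (h : HasStack t []) : t.read = Cell.leftEnd := by
  simp [Tape.read, h.1]

theorem HasStack.read_cons {t : Tape TapeLetter} {a : StackLetter} {s : List StackLetter}
    (h : HasStack t (a :: s)) : t.read = Cell.letter (Letter.work a) := by
  have h1 := h.1
  have h2 := h.2.1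
  rw [List.length_cons] at h1
  simp [Tape.read, h1, h2]

/-- Popping merely moves the head: `Stacked` leaves the cells above the stack arbitrary, so nothing
has to be erased. On the empty stack the head stays on `⊞`. -/
theorem HasStack.pop {t : Tape TapeLetter} {s : List StackLetter} (h : HasStack t s) :
    HasStack (t.act t.read.keep Move.left) s.tail := by
  refine ⟨by simp [Tape.act, h.1], ?_⟩
  rw [t.act_keep]
  cases s with
  | nil => trivial
  | cons a s => exact h.2.2

theorem HasStack.right {t : Tape TapeLetter} {s : List StackLetter} (h : HasStack t s) :
    AboveStack (t.act t.read.keep Move.right) s := by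
  refine ⟨by simp [Tape.act, h.1], ?_⟩
  rw [t.act_keep]
  exact h.2

theorem AboveStack.push_stay {t : Tape TapeLetter} {s : List StackLetter} (h : AboveStack t s)
    (a : StackLetter) : HasStack (t.act (some (Letter.work a)) Move.stay) (a :: s) := by
  refine ⟨by simp [Tape.act, h.1], ?_⟩
  simp only [Tape.act, h.1, Nat.add_one_ne_zero, if_false]
  exact ⟨by simp, h.2.update (Nat.lt_succ_self _) _⟩

theorem AboveStack.push_right {t : Tape TapeLetter} {s : List StackLetter} (h : AboveStack t s)
    (a : StackLetter) : AboveStack (t.act (some (Letter.work a)) Move.right) (a :: s) := by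
  refine ⟨by simp [Tape.act, h.1], ?_⟩
  simp only [Tape.act, h.1, Nat.add_one_ne_zero, if_false]
  exact ⟨by simp, h.2.update (Nat.lt_succ_self _) _⟩

/-! ### The learner: the machine -/

/-- The cell holds the separator of the stack. -/
def Cell.isSep : Cell TapeLetter → Bool
  | .letter (.work none) => true
  | _ => false

/-- The cell holds the letter `a` of the stack. -/
def Cell.isStackLetter (a : Fin 3) : Cell TapeLetter → Bool
  | .letter (.work (some b)) => b = a
  | _ => false

/-- An entry of the stack ends above the cell. -/
def Cell.isEntryEnd : Cell TapeLetter → Bool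
  | .letter (.work none) => true
  | .leftEnd => true
  | _ => false

/-- The states of the learner. -/
inductive LearnerState
  | start | look | right (a : Fin 3) | push | mark | back | scan (e c : Bool) | wipe | halt
  deriving DecidableEq

namespace LearnerState

instance : Finite LearnerState :=
  Finite.of_surjective
    (fun u : Fin 3 ⊕ (Bool × Bool) ⊕ Fin 7 => match u with
      | .inl a => right a
      | .inr (.inl p) => scan p.1 p.2
      | .inr (.inr i) => ![start, look, push, mark, back, wipe, halt] i)
    (by
      rintro (_ | _ | a | _ | _ | _ | ⟨e, c⟩ | _ | _)
      · exact ⟨.inr (.inr 0), rfl⟩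
      · exact ⟨.inr (.inr 1), rfl⟩
      · exact ⟨.inl a, rfl⟩
      · exact ⟨.inr (.inr 2), rfl⟩
      · exact ⟨.inr (.inr 3), rfl⟩
      · exact ⟨.inr (.inr 4), rfl⟩
      · exact ⟨.inr (.inl (e, c)), rfl⟩
      · exact ⟨.inr (.inr 5), rfl⟩
      · exact ⟨.inr (.inr 6), rfl⟩)

/-- The transitions of the learner. While the memory is empty, the datum is pushed on the stack
(`right`, `push`), unless it ends with `2` and becomes the memory (`right`, `mark`, `back`). If the
memory is `x f`, then the learner compares `x` with the datum and with the topmost entry of the stack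
(`scan e c`, where `e` and `c` tell whether they agree so far). -/
def next : LearnerState → Cell TapeLetter → Cell TapeLetter →
    LearnerState × (Option TapeLetter × Move) × (Option TapeLetter × Move)
  | start, b, v => (look, (b.keep, .right), (v.keep, .stay))
  -- A nonempty memory shows in the first letter. The top of the stack is popped in any case, and
  -- the entry below it is compared only if that top was a separator.
  | look, .letter (.inp (d, some g)), v =>
    (scan true v.isSep, (some (.inp (d, some g)), .stay), (v.keep, .left))
  | look, .letter (.inp (some a, none)), v =>
    (right a, (some (.inp (some a, none)), .right), (v.keep, .stay))
  | look, b, v => (push, (b.keep, .left), (v.keep, .right))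
  | right _, .letter (.inp (some a, g)), v =>
    (right a, (some (.inp (some a, g)), .right), (v.keep, .stay))
  | right a, b, v =>
    if a = 2 then (mark, (b.keep, .left), (v.keep, .stay))
    else (push, (b.keep, .left), (v.keep, .right))
  -- The datum is read backwards, so its first letter ends up nearest the top, ready for a
  -- left-to-right comparison. Erasing the base tape leaves memory and conjecture empty.
  | push, .letter (.inp (some a, _)), _ => (push, (none, .left), (some (.work (some a)), .right))
  | push, b, _ => (halt, (b.keep, .stay), (some (.work none), .stay))
  -- The final `2` of the datum is replaced by the flag `false` and by the last letter of the
  -- conjecture `x0`.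
  | mark, _, v => (back, (some (.out (some (.inr false), some 0)), .left), (v.keep, .stay))
  | back, .letter (.inp (some a, _)), v =>
    (back, (some (.out (some (.inl a), some a)), .left), (v.keep, .stay))
  | back, b, v => (halt, (b.keep, .stay), (v.keep, .stay))
  | scan e c, .letter (.inp (d, some (.inl a))), v =>
    (scan (e && d = some a) (c && v.isStackLetter a),
      (some (.out (some (.inl a), some a)), .right),
      (v.keep, if c && v.isStackLetter a then .left else .stay))
  -- At the end of `x`, equality with the datum or the stack entry also requires that the latter
  -- ends here.
  | scan e c, .letter (.inp (d, some (.inr f))), v =>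
    (wipe, (some (.out (some (.inr (f || (e && d = none) || (c && v.isEntryEnd))),
      some (bit (f || (e && d = none) || (c && v.isEntryEnd))))), .right), (v.keep, .stay))
  | wipe, _, v => (halt, (none, .stay), (v.keep, .stay))
  | _, b, v => (halt, (b.keep, .stay), (v.keep, .stay))

end LearnerState

/-- The linear-time learner. -/
def learner : Machine 1 TapeLetter LearnerState where
  start := .start
  final := fun q => q = .halt
  next := fun q b v =>
    ((q.next b (v 0)).1, (q.next b (v 0)).2.1, fun _ => (q.next b (v 0)).2.2)

/-- A configuration of the learner. -/
def learnerConfig (q : LearnerState) (b t : Tape TapeLetter) : Config 1 TapeLetter LearnerState :=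
  ⟨q, b, fun _ => t⟩

theorem learner_step {q : LearnerState} (hq : q ≠ .halt) (b t : Tape TapeLetter) :
    learner.step (learnerConfig q b t) =
      learnerConfig (q.next b.read t.read).1
        (b.act (q.next b.read t.read).2.1.1 (q.next b.read t.read).2.1.2)
        (t.act (q.next b.read t.read).2.2.1 (q.next b.read t.read).2.2.2) := by
  simp [learner, Machine.step, learnerConfig, hq]

theorem learner_reaches_cons {q q' : LearnerState} {b b' t t' : Tape TapeLetter} {N n : ℕ}
    {s s' : Option TapeLetter} {m m' : Move} {c : Config 1 TapeLetter LearnerState}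
    (hq : q ≠ .halt) (hN : b.head ≤ N)
    (hnext : q.next b.read t.read = (q', (s, m), (s', m')))
    (hb : b.act s m = b') (ht : t.act s' m' = t')
    (h : learner.Reaches N (learnerConfig q' b' t') n c) :
    learner.Reaches N (learnerConfig q b t) (n + 1) c := by
  refine .cons hN ?_
  rw [learner_step hq, hnext]
  subst hb ht
  exact h

/-- A letter of the base tape when the memory is empty. -/
def datLetter (a : Fin 3) : TapeLetter :=
  .inp (some a, none)

/-- A letter of the base tape at the end of a cycle. -/
def copyLetter (a : Fin 3) : TapeLetter :=
  .out (some (.inl a), some a)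

theorem conv_nil_right {A B : Type} (x : List A) :
    conv x ([] : List B) = x.map fun a => (some a, none) := by
  induction x with
  | nil => simp
  | cons a x ih => simp [ih]

theorem inputWord_nil (dat : List (Fin 3)) :
    (inputWord dat [] : List TapeLetter) = dat.map datLetter := by
  rw [inputWord, conv_nil_right, List.map_map]
  rfl

/-- Memory and conjecture have equal length and agree letter by letter on `x`, so a single sweep
writes both. -/
theorem outputWord_memo (x : List (Fin 3)) (f : Bool) (a : Fin 3) :
    (outputWord (memo x f) (x ++ [a]) : List TapeLetter) =
      x.map copyLetter ++ [.out (some (.inr f), some a)] := by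
  unfold outputWord memo
  induction x with
  | nil => simp
  | cons b x ih => simpa [copyLetter] using ih

theorem reaches_right (t : Tape TapeLetter) {N : ℕ} (r : List (Fin 3)) (a : Fin 3)
    (l : List TapeLetter) (hN : l.length + 1 + r.length ≤ N) :
    learner.Reaches N (learnerConfig (.right a) (.focus l (r.map datLetter)) t) r.length
      (learnerConfig (.right (r.getLastD a)) (.focus ((r.map datLetter).reverse ++ l) []) t) := by
  induction r generalizing a l with
  | nil => exact .refl (by simpa [learnerConfig] using hN)
  | cons a' r ih =>
    rw [List.length_cons] at hN
    refine learner_reaches_cons (by simp) (by simp; omega)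
      (by rw [List.map_cons, Tape.read_focus_cons]; rfl)
      (Tape.act_focus_right _ _ _ _) t.act_keep_stay ?_
    rw [List.getLastD_cons, List.map_cons, List.reverse_cons, List.append_assoc]
    exact ih a' (datLetter a' :: l) (by simp; omega)

theorem reaches_push {N : ℕ} (l : List (Fin 3)) (t : Tape TapeLetter) (s : List StackLetter)
    (hs : AboveStack t s) (hN : l.length ≤ N) :
    ∃ t', learner.Reaches N (learnerConfig .push (.leftOf (l.map datLetter) []) t) (l.length + 1)
        (learnerConfig .halt (.ofWord []) t') ∧
      HasStack t' (none :: (l.reverse.map some ++ s)) := by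
  induction l generalizing t s with
  | nil =>
    exact ⟨_, learner_reaches_cons (by simp) (by simp)
      (by rw [List.map_nil, Tape.leftOf, Tape.read_ofWord]; rfl)
      (Tape.act_ofWord_stay _ _) rfl (.refl (by simp [learnerConfig])), hs.push_stay none⟩
  | cons a l ih =>
    rw [List.length_cons] at hN
    obtain ⟨t', h1, h2⟩ := ih _ _ (hs.push_right (some a)) (by omega)
    refine ⟨t', learner_reaches_cons (by simp) (by simpa using hN)
      (by rw [List.map_cons, Tape.leftOf, Tape.read_focus_cons]; rfl)
      (Tape.act_focus_none_left _ _ (by simp)) rfl h1, by simpa using h2⟩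

theorem reaches_back {N : ℕ} (l : List (Fin 3)) (r : List TapeLetter) (t : Tape TapeLetter)
    (hN : l.length ≤ N) :
    learner.Reaches N (learnerConfig .back (.leftOf (l.map datLetter) r) t) (l.length + 1)
      (learnerConfig .halt (.ofWord (l.reverse.map copyLetter ++ r)) t) := by
  induction l generalizing r with
  | nil =>
    exact learner_reaches_cons (by simp) (by simp)
      (by rw [List.map_nil, Tape.leftOf, Tape.read_ofWord]; rfl)
      (Tape.act_ofWord_stay _ _) t.act_keep_stay (.refl (by simp [learnerConfig]))
  | cons a l ih =>
    rw [List.length_cons] at hN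
    refine learner_reaches_cons (by simp) (by simpa using hN)
      (by rw [List.map_cons, Tape.leftOf, Tape.read_focus_cons]; rfl)
      (Tape.act_focus_left _ _ _ _) t.act_keep_stay ?_
    simpa [copyLetter] using ih (copyLetter a :: r) (by omega)

theorem conv_memo_nil (d : List (Fin 3)) (f : Bool) :
    conv d (memo [] f) = (d.head?, some (.inr f)) :: conv d.tail [] := by
  cases d <;> simp [memo]

theorem conv_memo_cons (d : List (Fin 3)) (a : Fin 3) (x : List (Fin 3)) (f : Bool) :
    conv d (memo (a :: x) f) = (d.head?, some (.inl a)) :: conv d.tail (memo x f) := by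
  cases d <;> simp [memo]

/-- Induction on the unread part of `x`: `e` and `c` record the comparisons made so far, while `d`
and `s` are the unread rests of the datum and the stack. -/
theorem reaches_scan {N : ℕ} (x : List (Fin 3)) (f e c : Bool) (d : List (Fin 3))
    (l : List TapeLetter) (t : Tape TapeLetter) (s : List StackLetter) (hs : HasStack t s)
    (hN : l.length + x.length + 2 ≤ N) :
    ∃ b' t' f', learner.Reaches N
        (learnerConfig (.scan e c) (.focus l (inputWord d (memo x f))) t) (x.length + 2)
        (learnerConfig .halt b' t') ∧
      f' = (f || (e && d = x) || (c && (matchStack x s).1)) ∧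
      b'.Holds (l.reverse ++ outputWord (memo x f') (x ++ [bit f'])) ∧
      HasStack t' (if c then (matchStack x s).2 else s) := by
  induction x generalizing e c d l t s with
  | nil =>
    simp only [List.length_nil, Nat.add_zero] at hN
    set f' := f || (e && d.head? = none) || (c && t.read.isEntryEnd)
    set l' : List TapeLetter := .out (some (.inr f'), some (bit f')) :: l
    set r : List TapeLetter := (conv d.tail []).map Letter.inp
    have hwipe : learner.Reaches N (learnerConfig .wipe (.focus l' r) t) 1
        (learnerConfig .halt ((Tape.focus l' r).act none .stay) t) :=
      learner_reaches_cons (by simp) (by simp [l']; omega) rfl rfl t.act_keep_stay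
        (.refl (by simp [Tape.act, learnerConfig, l']; omega))
    refine ⟨_, t, f', learner_reaches_cons (by simp) (by simp; omega)
      (by rw [inputWord, conv_memo_nil, List.map_cons, Tape.read_focus_cons]; rfl)
      (by rw [inputWord, conv_memo_nil, List.map_cons]; exact Tape.act_focus_right _ _ _ _)
      t.act_keep_stay hwipe, ?_, ?_, ?_⟩
    · rcases s with _ | ⟨_ | a, s⟩
      · simp only [f', hs.read_nil]
        cases d <;> simp [matchStack, Cell.isEntryEnd]
      · simp only [f', hs.read_cons]
        cases d <;> simp [matchStack, Cell.isEntryEnd]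
      · simp only [f', hs.read_cons]
        cases d <;> simp [matchStack, Cell.isEntryEnd]
    · rw [outputWord_memo]
      convert Tape.holds_act_focus_none_stay l' r using 1
      simp [l']
    · rcases s with _ | ⟨_ | a, s⟩ <;> simpa [matchStack] using hs
  | cons a x ih =>
    rw [List.length_cons] at hN
    set m := c && t.read.isStackLetter a with hm
    -- One machine step is one unfolding of `matchStack`: `s'` is the stack after popping a matching
    -- letter, and `s` itself otherwise.
    have key : ∃ s', HasStack (t.act t.read.keep (if m then .left else .stay)) s' ∧
        (m && (matchStack x s').1) = (c && (matchStack (a :: x) s).1) ∧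
        (if m then (matchStack x s').2 else s') = if c then (matchStack (a :: x) s).2 else s := by
      cases c with
      | false => exact ⟨s, by simpa [hm, t.act_keep_stay] using hs, by simp [hm]⟩
      | true =>
        rcases s with _ | ⟨_ | b, s⟩
        · rw [hs.read_nil] at hm
          exact ⟨[], by simpa [hm, t.act_keep_stay, Cell.isStackLetter] using hs,
            by simp [hm, matchStack, Cell.isStackLetter]⟩
        · rw [hs.read_cons] at hm
          exact ⟨_, by simpa [hm, t.act_keep_stay, Cell.isStackLetter] using hs,
            by simp [hm, matchStack, Cell.isStackLetter]⟩
        · rw [hs.read_cons] at hm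
          by_cases hb : b = a
          · exact ⟨s, by simpa [hm, Cell.isStackLetter, hb] using hs.pop,
              by simp [hm, matchStack, Cell.isStackLetter, hb]⟩
          · exact ⟨_, by simpa [hm, t.act_keep_stay, Cell.isStackLetter, hb] using hs,
              by simp [hm, matchStack, Cell.isStackLetter, hb]⟩
    obtain ⟨s', hs', h1, h2⟩ := key
    obtain ⟨b', t', f', hr, hf', hb', ht'⟩ := ih (e && d.head? = some a) m d.tail
      (copyLetter a :: l) _ _ hs' (by rw [List.length_cons]; omega)
    refine ⟨b', t', f', learner_reaches_cons (by simp) (by simp; omega)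
      (by rw [inputWord, conv_memo_cons, List.map_cons, Tape.read_focus_cons]; rfl)
      (by rw [inputWord, conv_memo_cons, List.map_cons]; exact Tape.act_focus_right _ _ _ _)
      rfl hr, ?_, ?_, ?_⟩
    · rw [hf', h1]
      congr 2
      cases d <;> cases e <;> simp
      congr
    · rw [outputWord_memo] at hb' ⊢
      simpa using hb'
    · rwa [← h2]

/-! ### One cycle of the learner -/

/-- What the learner knows: nothing, or that `x2` is among the data, together with a flag that tells
whether `x` is known to be among the data. -/
abbrev Knowledge : Type :=
  Option (List (Fin 3) × Bool)

/-- The memory of the learner. -/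
def Knowledge.encode : Knowledge → List MemLetter
  | none => []
  | some (x, f) => memo x f

/-- The conjecture of the learner. -/
def Knowledge.conjecture : Knowledge → List (Fin 3)
  | none => []
  | some (x, f) => x ++ [bit f]

/-- The effect of one cycle on the knowledge and on the stack. -/
def updateKnowledge (dat : List (Fin 3)) :
    Knowledge × List StackLetter → Knowledge × List StackLetter
  | (none, s) =>
    if dat.getLast? = some 2 then (some (dat.dropLast, false), s)
    else (none, none :: (dat.map some ++ s))
  | (some (x, f), s) => (some (x, f || dat = x || (searchStack x s).1), (searchStack x s).2)

theorem length_memo (x : List (Fin 3)) (f : Bool) : (memo x f).length = x.length + 1 := by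
  simp [memo]

theorem learner_cycle_of_reaches {ℓ n : ℕ} {dat nc : List (Fin 3)} {om nm : List MemLetter}
    {b' t t' : Tape TapeLetter}
    (h : learner.Reaches (ℓ + 3) (learnerConfig .start (.ofWord (inputWord dat om)) t) n
      (learnerConfig .halt b' t'))
    (hn : n ≤ 3 * (max dat.length om.length + 1)) (hb : b'.Holds (outputWord nm nc))
    (hnm : nm.length ≤ ℓ + 3) (hnc : nc.length ≤ ℓ + 3) :
    learner.Cycle 3 ℓ dat om (fun _ => t) nm nc (fun _ => t') := by
  have hbegin : learner.begin dat om (fun _ => t) =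
    learnerConfig .start (.ofWord (inputWord dat om)) t := rfl
  rw [Machine.Cycle, length_conv, length_conv, hbegin]
  refine ⟨⟨n, hn, ?_⟩, max_le hnm hnc, h.head_le rfl⟩
  rw [h.1]
  exact ⟨rfl, hb, rfl⟩

theorem reaches_turn (dat : List (Fin 3)) (t : Tape TapeLetter) {N : ℕ}
    (hN : dat.length + 1 ≤ N) :
    learner.Reaches N (learnerConfig .start (.ofWord (dat.map datLetter)) t) (dat.length + 2)
      (if dat.getLast? = some 2 then
        learnerConfig .mark (.leftOf (dat.reverse.map datLetter) []) t
      else learnerConfig .push (.leftOf (dat.reverse.map datLetter) [])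
        (t.act t.read.keep .right)) := by
  refine learner_reaches_cons (by simp) (by simp) rfl (Tape.act_ofWord_right _ _)
    t.act_keep_stay ?_
  cases dat with
  | nil =>
    exact learner_reaches_cons (by simp) (by simpa using hN)
      (by rw [List.map_nil, Tape.read_focus_nil]; rfl)
      (Tape.act_focus_none_left _ _ (by simp)) rfl (.refl (by simp [learnerConfig]))
  | cons a r =>
    rw [List.length_cons] at hN
    refine learner_reaches_cons (by simp) (by simp; omega)
      (by rw [List.map_cons, Tape.read_focus_cons]; rfl)
      (Tape.act_focus_right _ _ _ _) t.act_keep_stay ?_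
    have h1 := reaches_right t r a [datLetter a] (N := N) (by simp; omega)
    have hl : (r.map datLetter).reverse ++ [datLetter a] = (a :: r).reverse.map datLetter := by
      simp
    rw [hl] at h1
    rw [List.length_cons, Nat.add_comm]
    refine h1.trans ?_
    have hlast : (a :: r).getLast? = some (r.getLastD a) := by
      rw [List.getLast?_cons, ← List.getLastD_eq_getLast?]
    have hread : (Tape.focus ((a :: r).reverse.map datLetter) []).read = Cell.blank :=
      Tape.read_focus_nil _
    by_cases ha : r.getLastD a = 2
    · rw [if_pos (by rw [hlast, ha])]
      exact learner_reaches_cons (by simp) (by simp; omega)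
        (by rw [hread]; simp only [LearnerState.next]; rw [if_pos ha]; rfl)
        (Tape.act_focus_none_left _ _ (by simp)) t.act_keep_stay
        (.refl (by simp [learnerConfig]; omega))
    · rw [if_neg (by rwa [hlast, Option.some_inj])]
      exact learner_reaches_cons (by simp) (by simp; omega)
        (by rw [hread]; simp only [LearnerState.next]; rw [if_neg ha]; rfl)
        (Tape.act_focus_none_left _ _ (by simp)) rfl
        (.refl (by simp [learnerConfig]; omega))

theorem exists_inputWord_memo (d x : List (Fin 3)) (f : Bool) :
    ∃ p g r, (inputWord d (memo x f) : List TapeLetter) = .inp (p, some g) :: r := by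
  cases x with
  | nil => rw [inputWord, conv_memo_nil]; exact ⟨_, _, _, rfl⟩
  | cons a x => rw [inputWord, conv_memo_cons]; exact ⟨_, _, _, rfl⟩

/-- Rewrites the search in the order of the machine: pop unconditionally, then match if the popped
symbol was a separator. -/
theorem HasStack.searchStack_eq {t : Tape TapeLetter} {s : List StackLetter} (h : HasStack t s)
    (x : List (Fin 3)) : searchStack x s =
      (t.read.isSep && (matchStack x s.tail).1,
        if t.read.isSep then (matchStack x s.tail).2 else s.tail) := by
  rcases s with _ | ⟨_ | a, s⟩
  · simp [h.read_nil, searchStack, Cell.isSep]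
  · simp [h.read_cons, searchStack, Cell.isSep]
  · simp [h.read_cons, searchStack, Cell.isSep]

theorem exists_learner_reaches (dat : List (Fin 3)) (κ : Knowledge × List StackLetter)
    (t : Tape TapeLetter) (ht : HasStack t κ.2) :
    ∃ n b' t', n ≤ 3 * (max dat.length κ.1.encode.length + 1) ∧
      learner.Reaches (max dat.length κ.1.encode.length + 3)
        (learnerConfig .start (.ofWord (inputWord dat κ.1.encode)) t) n
        (learnerConfig .halt b' t') ∧
      b'.Holds (outputWord (updateKnowledge dat κ).1.encode (updateKnowledge dat κ).1.conjecture) ∧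
      HasStack t' (updateKnowledge dat κ).2 := by
  obtain ⟨_ | ⟨x, f⟩, s⟩ := κ
  · simp only [Knowledge.encode, inputWord_nil, List.length_nil, Nat.max_zero]
    have hturn := reaches_turn dat t (N := dat.length + 3) (by omega)
    by_cases h2 : dat.getLast? = some 2
    · rw [if_pos h2] at hturn
      simp only [updateKnowledge, if_pos h2]
      obtain ⟨x, rfl⟩ := List.getLast?_eq_some_iff.1 h2
      rw [List.length_append, List.length_singleton] at hturn ⊢
      have hback := reaches_back (N := x.length + 1 + 3) x.reverse
        [.out (some (.inr false), some 0)] t (by simp; omega)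
      have hmark : learner.Reaches (x.length + 1 + 3) _ (x.reverse.length + 1 + 1) _ :=
        learner_reaches_cons (q := .mark)
          (b := .leftOf ((x ++ [2]).reverse.map datLetter) []) (by simp) (by simp) rfl
          (by rw [List.reverse_append, List.reverse_singleton, List.singleton_append,
            List.map_cons, Tape.leftOf]; exact Tape.act_focus_left _ _ _ _)
          t.act_keep_stay hback
      refine ⟨_, _, t, ?_, hturn.trans hmark, ?_, ht⟩
      · rw [List.length_reverse]; omega
      · rw [List.dropLast_concat, List.reverse_reverse]
        simp only [Knowledge.conjecture, outputWord_memo]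
        exact Tape.holds_ofWord _
    · rw [if_neg h2] at hturn
      simp only [updateKnowledge, if_neg h2]
      obtain ⟨t', h, hs⟩ := reaches_push (N := dat.length + 3) dat.reverse _ s ht.right
        (by simp)
      refine ⟨_, _, t', ?_, hturn.trans h, Tape.holds_ofWord _, ?_⟩
      · rw [List.length_reverse]; omega
      · rwa [List.reverse_reverse] at hs
  · simp only [Knowledge.encode, length_memo]
    obtain ⟨b', t', f', hr, hf', hb', ht'⟩ := reaches_scan
      (N := max dat.length (x.length + 1) + 3) x f true t.read.isSep dat [] _ _ ht.pop
      (by simp; omega)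
    obtain ⟨p, g, r, hin⟩ := exists_inputWord_memo dat x f
    have hsearch := ht.searchStack_eq x
    refine ⟨x.length + 2 + 1 + 1, b', t', by omega,
      learner_reaches_cons (by simp) (by simp) rfl (Tape.act_ofWord_right _ _) t.act_keep_stay
        (learner_reaches_cons (by simp) (by simp) (by rw [hin, Tape.read_focus_cons]; rfl)
          (by rw [hin]; exact Tape.act_focus_stay _ _ _ _) rfl (hin ▸ hr)), ?_, ?_⟩
    · simp only [updateKnowledge, Knowledge.conjecture, hsearch]
      rw [Bool.true_and] at hf'
      rw [← hf']
      exact hb'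
    · simpa only [updateKnowledge, hsearch] using ht'

theorem length_conjecture_le (κ : Knowledge) : κ.conjecture.length ≤ κ.encode.length := by
  obtain _ | ⟨x, f⟩ := κ
  · rfl
  · simp [Knowledge.conjecture, Knowledge.encode, length_memo]

theorem length_encode_updateKnowledge_le (dat : List (Fin 3))
    (κ : Knowledge × List StackLetter) :
    (updateKnowledge dat κ).1.encode.length ≤ max dat.length κ.1.encode.length := by
  obtain ⟨_ | ⟨x, f⟩, s⟩ := κ
  · by_cases h2 : dat.getLast? = some 2
    · simp only [updateKnowledge, if_pos h2]
      obtain ⟨x, rfl⟩ := List.getLast?_eq_some_iff.1 h2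
      simp [Knowledge.encode, length_memo]
    · simp [updateKnowledge, if_neg h2, Knowledge.encode]
  · simp [updateKnowledge, Knowledge.encode, length_memo]

/-- The final work tape is chosen before `ℓ`, so that it depends only on datum, knowledge and tape
and can be iterated over the cycles. -/
theorem exists_learner_cycle (dat : List (Fin 3)) (κ : Knowledge × List StackLetter)
    (t : Tape TapeLetter) (ht : HasStack t κ.2) :
    ∃ t', HasStack t' (updateKnowledge dat κ).2 ∧
      ∀ ℓ, dat.length ≤ ℓ → κ.1.encode.length ≤ ℓ →
        learner.Cycle 3 ℓ dat κ.1.encode (fun _ => t) (updateKnowledge dat κ).1.encode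
          (updateKnowledge dat κ).1.conjecture (fun _ => t') := by
  obtain ⟨n, b', t', hn, h, hb, ht'⟩ := exists_learner_reaches dat κ t ht
  refine ⟨t', ht', fun ℓ h1 h2 => ?_⟩
  have h3 := length_encode_updateKnowledge_le dat κ
  have h4 := length_conjecture_le (updateKnowledge dat κ).1
  exact learner_cycle_of_reaches (h.mono (by omega)) hn hb (by omega) (by omega)

/-! ### The search on the stack -/

/-- The stack with the given entries. -/
def stackOf : List (List (Fin 3)) → List StackLetter
  | [] => []
  | v :: vs => none :: (v.map some ++ stackOf vs)

/-- The separator, or the bottom of the stack, stops the comparison within the topmost entry `v`;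
the entries `vs` stay intact, above them a remnant `v'` of `v`. -/
theorem exists_matchStack_eq (x v : List (Fin 3)) (vs : List (List (Fin 3))) :
    ∃ v' : List (Fin 3), matchStack x (v.map some ++ stackOf vs) =
      (decide (v = x), v'.map some ++ stackOf vs) ∧ v'.length ≤ v.length := by
  induction x generalizing v with
  | nil =>
    rcases v with _ | ⟨a, v⟩
    · exact ⟨[], by cases vs <;> simp [stackOf, matchStack], le_rfl⟩
    · exact ⟨a :: v, by simp [matchStack], le_rfl⟩
  | cons a x ih =>
    rcases v with _ | ⟨b, v⟩
    · exact ⟨[], by cases vs <;> simp [stackOf, matchStack], le_rfl⟩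
    · by_cases hb : b = a
      · obtain ⟨v', h, hl⟩ := ih v
        refine ⟨v', ?_, hl.trans (Nat.le_succ _)⟩
        simp [matchStack, hb, h]
      · exact ⟨b :: v, by simp [matchStack, hb], le_rfl⟩

/-- Here `u` is the remnant of an entry already rejected or matched. A search loses at least one
symbol of a nonempty stack, raises no false alarm, and never discards an entry `x` without reporting
it. -/
theorem exists_searchStack_eq (x u : List (Fin 3)) (vs : List (List (Fin 3))) :
    ∃ (u' : List (Fin 3)) (vs' : List (List (Fin 3))),
      (searchStack x (u.map some ++ stackOf vs)).2 = u'.map some ++ stackOf vs' ∧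
      (u'.map some ++ stackOf vs').length ≤ (u.map some ++ stackOf vs).length - 1 ∧
      vs' ⊆ vs ∧
      ((searchStack x (u.map some ++ stackOf vs)).1 = true → x ∈ vs) ∧
      (x ∈ vs → (searchStack x (u.map some ++ stackOf vs)).1 = true ∨ x ∈ vs') := by
  rcases u with _ | ⟨a, u⟩
  · rcases vs with _ | ⟨v, vs⟩
    · exact ⟨[], [], by simp [stackOf, searchStack]⟩
    · obtain ⟨v', h, hl⟩ := exists_matchStack_eq x v vs
      refine ⟨v', vs, ?_⟩
      simp only [List.map_nil, List.nil_append, stackOf, searchStack, h]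
      refine ⟨trivial, by simpa using hl, by simp, ?_, ?_⟩ <;>
        simp +contextual [eq_comm]
  · exact ⟨u, vs, by simp [searchStack]⟩

/-! ### Convergence of the learner -/

/-- Knowledge and stack of the learner before the datum `w n` is processed. -/
def knowledgeAt (w : ℕ → List (Fin 3)) : ℕ → Knowledge × List StackLetter
  | 0 => (none, [])
  | n + 1 => updateKnowledge (w n) (knowledgeAt w n)

theorem getLast?_ne_two {x : List (Fin 3)} (hx : x ∈ binaryWords) : x.getLast? ≠ some 2 := by
  intro h
  have := hx 2 (List.mem_of_getLast? h)
  simp at this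

theorem exists_knowledgeAt_eq_none {w : ℕ → List (Fin 3)} {n : ℕ}
    (h : ∀ i < n, w i ∈ binaryWords) :
    ∃ vs, knowledgeAt w n = (none, stackOf vs) ∧ ∀ v, v ∈ vs ↔ ∃ i < n, w i = v := by
  induction n with
  | zero => exact ⟨[], rfl, by simp⟩
  | succ n ih =>
    obtain ⟨vs, h1, h2⟩ := ih fun i hi => h i (by omega)
    refine ⟨w n :: vs, ?_, fun v => ?_⟩
    · rw [knowledgeAt, h1, updateKnowledge, if_neg (getLast?_ne_two (h n (by omega))), stackOf]
    · rw [List.mem_cons, h2]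
      constructor
      · rintro (rfl | ⟨i, hi, rfl⟩)
        · exact ⟨n, by omega, rfl⟩
        · exact ⟨i, by omega, rfl⟩
      · rintro ⟨i, hi, rfl⟩
        rcases Nat.lt_succ_iff_lt_or_eq.1 hi with hi | rfl
        · exact Or.inr ⟨i, hi, rfl⟩
        · exact Or.inl rfl

/-- The invariant after `x2`: a raised flag is correct, and if `x` has occurred, then the flag is
raised or `x` is still a complete entry. The bound `b - n` empties the stack after `b` cycles, which
rules out the second alternative. -/
theorem exists_knowledgeAt_eq_some {w : ℕ → List (Fin 3)} {x : List (Fin 3)} {k : ℕ}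
    (hlt : ∀ i < k, w i ∈ binaryWords) (hk : w k = x ++ [2]) :
    ∃ b, ∀ n, ∃ (f : Bool) (u : List (Fin 3)) (vs : List (List (Fin 3))),
      knowledgeAt w (k + 1 + n) = (some (x, f), u.map some ++ stackOf vs) ∧
      (u.map some ++ stackOf vs).length ≤ b - n ∧
      (∀ v ∈ vs, v ∈ Set.range w) ∧ (f = true → x ∈ Set.range w) ∧
      (∀ i < k + 1 + n, w i = x → f = true ∨ x ∈ vs) := by
  obtain ⟨vs, h1, h2⟩ := exists_knowledgeAt_eq_none hlt
  refine ⟨(stackOf vs).length, fun n => ?_⟩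
  induction n with
  | zero =>
    refine ⟨false, [], vs, ?_, by simp, fun v hv => ?_, by simp, fun i hi hx => ?_⟩
    · rw [Nat.add_zero, knowledgeAt, h1, updateKnowledge, if_pos (by simp [hk]), hk]
      simp
    · obtain ⟨i, -, rfl⟩ := (h2 v).1 hv
      exact ⟨i, rfl⟩
    · rcases Nat.lt_succ_iff_lt_or_eq.1 hi with hi | rfl
      · exact Or.inr ((h2 x).2 ⟨i, hi, hx⟩)
      · simp [hk] at hx
  | succ n ih =>
    obtain ⟨f, u, vs, hκ, hlen, hvs, hf, hx⟩ := ih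
    obtain ⟨u', vs', hs, hlen', hsub, hs1, hs2⟩ := exists_searchStack_eq x u vs
    refine ⟨f || w (k + 1 + n) = x || (searchStack x (u.map some ++ stackOf vs)).1, u', vs', ?_,
      by omega, fun v hv => hvs v (hsub hv), ?_, fun i hi hi' => ?_⟩
    · rw [← Nat.add_assoc, knowledgeAt, hκ, updateKnowledge, hs]
    · simp only [Bool.or_eq_true, decide_eq_true_eq]
      rintro ((h | h) | h)
      · exact hf h
      · exact ⟨_, h⟩
      · exact hvs x (hs1 h)
    · simp only [Bool.or_eq_true, decide_eq_true_eq]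
      rcases Nat.lt_succ_iff_lt_or_eq.1 hi with hi | rfl
      · rcases hx i hi hi' with h | h
        · exact Or.inl (Or.inl (Or.inl h))
        · rcases hs2 h with h | h
          · exact Or.inl (Or.inr h)
          · exact Or.inr h
      · exact Or.inl (Or.inl (Or.inr hi'))

theorem converges_of_text_append {w : ℕ → List (Fin 3)} {x : List (Fin 3)} {a : Fin 3}
    (hx : x ∈ binaryWords) (ha : a = 0 ∨ a = 1) (hw : IsText w (lang (x ++ [a]))) :
    (∀ n, (knowledgeAt w (n + 1)).1.conjecture ∈ binaryWords) ∧
      ConvergesTo binaryWords lang (fun n => (knowledgeAt w (n + 1)).1.conjecture)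
        (lang (x ++ [a])) := by
  have hmem : ∀ v, v ∈ Set.range w ↔ v ∈ lang (x ++ [a]) := fun v => by rw [← hw]
  have hex : ∃ k, w k = x ++ [2] := by
    refine (hmem _).2 ?_
    rcases ha with rfl | rfl
    · simp [lang_append_zero]
    · simp [lang_append_one]
  classical
  -- The first occurrence of `x2`: all earlier data are binary and hence were pushed.
  set k := Nat.find hex
  have hk : w k = x ++ [2] := Nat.find_spec hex
  have hlt : ∀ i < k, w i ∈ binaryWords := by
    intro i hi
    have h1 := (hmem (w i)).1 ⟨i, rfl⟩
    have h2 : w i ≠ x ++ [2] := Nat.find_min hex hi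
    rcases ha with rfl | rfl
    · rw [lang_append_zero] at h1
      exact h1.1.resolve_right h2
    · rw [lang_append_one] at h1
      exact h1.resolve_right h2
  obtain ⟨b, hb⟩ := exists_knowledgeAt_eq_some hlt hk
  have hbit : ∀ f, bit f = 0 ∨ bit f = 1 := by intro f; cases f <;> simp [bit]
  have hlim : ∃ m, ∀ n ≥ m, (knowledgeAt w (n + 1)).1.conjecture = x ++ [a] := by
    rcases ha with rfl | rfl
    · refine ⟨k, fun n hn => ?_⟩
      obtain ⟨d, rfl⟩ := Nat.exists_eq_add_of_le hn
      obtain ⟨f, u, vs, hκ, -, -, hf, -⟩ := hb d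
      rw [show k + d + 1 = k + 1 + d by omega, hκ]
      cases f with
      | false => rfl
      | true =>
        have := (hmem x).1 (hf rfl)
        rw [lang_append_zero] at this
        exact absurd rfl this.2
    · obtain ⟨i, hi⟩ := (hmem x).2 (by rw [lang_append_one]; exact Or.inl hx)
      -- Late enough that `x2` and `w i = x` have both been read and the stack, of height at most
      -- `b` after cycle `k`, is empty.
      refine ⟨k + i + b, fun n hn => ?_⟩
      obtain ⟨d, rfl⟩ := Nat.exists_eq_add_of_le hn
      obtain ⟨f, u, vs, hκ, hlen, -, -, hf⟩ := hb (i + b + d)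
      rw [show k + i + b + d + 1 = k + 1 + (i + b + d) by omega, hκ]
      have hnil : vs = [] := by
        have h0 : (u.map some ++ stackOf vs).length = 0 := by omega
        cases vs with
        | nil => rfl
        | cons v vs => simp [stackOf] at h0
      rcases hf i (by omega) hi with rfl | h
      · rfl
      · simp [hnil] at h
  have hJ : x ++ [a] ∈ binaryWords := by simp [hx, ha]
  refine ⟨fun n => ?_, ?_⟩
  · rcases lt_or_ge n k with h | h
    · obtain ⟨vs, h1, -⟩ := exists_knowledgeAt_eq_none (n := n + 1) (w := w)
        fun i hi => hlt i (by omega)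
      rw [h1]
      exact nil_mem_binaryWords
    · obtain ⟨d, rfl⟩ := Nat.exists_eq_add_of_le h
      obtain ⟨f, u, vs, hκ, -⟩ := hb d
      rw [show k + d + 1 = k + 1 + d by omega, hκ]
      exact append_mem_binaryWords.2 ⟨hx, by simp [hbit f]⟩
  · obtain ⟨m, hm⟩ := hlim
    exact ⟨m, (congrArg (· ∈ binaryWords) (hm m le_rfl)).mpr hJ, congrArg lang (hm m le_rfl),
      fun n hn => (hm n hn).trans (hm m le_rfl).symm⟩

theorem converges_of_text {w : ℕ → List (Fin 3)} {e : List (Fin 3)} (he : e ∈ binaryWords)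
    (hw : IsText w (lang e)) :
    (∀ n, (knowledgeAt w (n + 1)).1.conjecture ∈ binaryWords) ∧
      ConvergesTo binaryWords lang (fun n => (knowledgeAt w (n + 1)).1.conjecture) (lang e) := by
  rcases List.eq_nil_or_concat' e with rfl | ⟨x, a, rfl⟩
  · rw [lang_nil, IsText] at hw
    have h : ∀ n, (knowledgeAt w (n + 1)).1.conjecture = [] := by
      intro n
      obtain ⟨vs, h1, -⟩ := exists_knowledgeAt_eq_none (n := n + 1) (w := w)
        fun i _ => hw ▸ ⟨i, rfl⟩
      rw [h1]
      rfl
    refine ⟨fun n => by rw [h]; exact nil_mem_binaryWords, 0, ?_, ?_, fun n _ => ?_⟩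
    · simp [h]
    · simp [h]
    · simp [h]
  · rw [append_mem_binaryWords, cons_mem_binaryWords] at he
    exact converges_of_text_append he.1 he.2.1 hw

theorem length_encode_knowledgeAt_le (w : ℕ → List (Fin 3)) (n : ℕ) :
    (knowledgeAt w n).1.encode.length ≤ longest w n := by
  induction n with
  | zero => exact Nat.zero_le _
  | succ n ih =>
    have h1 : longest w n ≤ longest w (n + 1) :=
      Finset.sup_mono (Finset.range_subset_range.2 (by omega))
    have h2 : (w n).length ≤ longest w n :=
      Finset.le_sup (f := fun i => (w i).length) (Finset.mem_range.2 (Nat.lt_succ_self n))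
    have h3 := length_encode_updateKnowledge_le (w n) (knowledgeAt w n)
    rw [knowledgeAt]
    omega

theorem hasLinearTimeLearner_lang : HasLinearTimeLearner 1 binaryWords lang binaryWords lang := by
  refine ⟨MemLetter, StackLetter, LearnerState, inferInstance, inferInstance, inferInstance,
    learner, [], 3, fun w => ?_⟩
  choose! tape hstack hcycle using exists_learner_cycle
  -- The actual tapes are iterated alongside the knowledge, since the stack does not determine the
  -- cells above it.
  let wk : ℕ → Tape TapeLetter := fun n =>
    n.rec (Tape.ofWord []) fun n t => tape (w n) (knowledgeAt w n) t
  have hwk : ∀ n, HasStack (wk n) (knowledgeAt w n).2 := by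
    intro n
    induction n with
    | zero => exact ⟨rfl, trivial⟩
    | succ n ih => exact hstack _ _ _ ih
  refine ⟨fun n => (knowledgeAt w n).1.encode, fun n => (knowledgeAt w (n + 1)).1.conjecture,
    fun n _ => wk n, rfl, rfl, fun n => ?_, fun e he hw => converges_of_text he hw⟩
  exact hcycle _ _ _ (hwk n) _
    (Finset.le_sup (f := fun i => (w i).length) (Finset.mem_range.2 (Nat.lt_succ_self n)))
    (length_encode_knowledgeAt_le w n)

end AutomaticLearning

theorem theorem3p5 :
    -- the family is automatic,
    IsAutomaticFamily binaryWords lang ∧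
    -- it has no automatic learner, whichever automatic hypothesis space is used,
    (∀ (E : Type) [Finite E] (J : Set (List E)) (H : List E → Set (List (Fin 3))),
      IsAutomaticFamily J H → IsHypothesisSpace J H binaryWords lang →
        ¬ HasAutomaticLearner J H binaryWords lang) ∧
    -- and it has a linear-time learner with one additional work tape, with the family itself as
    -- the hypothesis space.
    HasLinearTimeLearner 1 binaryWords lang binaryWords lang :=
  ⟨isAutomaticFamily_lang, fun _ _ J H _ _ => not_hasAutomaticLearner_lang J H,
    hasLinearTimeLearner_lang⟩
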